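/- Let $N\ge 1$ be an integer, $0<s<1$ and $1<p<\infty$ with $s\,p>N$, and set $\alpha=s-\frac{N}{p}\in(0,1)$. For $\varphi:\mathbb{R}^N\to\mathbb{R}$ put $$[\varphi]^p_{W^{s,p}}=\iint_{\mathbb{R}^N\times\mathbb{R}^N}\frac{|\varphi(x)-\varphi(y)|^p}{|x-y|^{N+s\,p}}\,dx\,dy,\qquad [\varphi]_{C^{0,\alpha}}=\sup_{x\neq y}\frac{|\varphi(x)-\varphi(y)|}{|x-y|^{\alpha}},$$ let $\mathcal{W}^{s,p}(\mathbb{R}^N)$ be the space of continuous $\varphi$ for which both quantities are finite, and let $J_p(t)=|t|^{p-2}\,t$. (1) Let $\mu$ be a compactly supported finite signed Borel measure on $\mathbb{R}^N$, with support $K$ (the support of $|\mu|$), and let $U\in\mathcal{W}^{s,p}(\mathbb{R}^N)$ be a weak solution of $(-\Delta_p)^sU=\mu$ in $\mathbb{R}^N$, i.e. $$\iint_{\mathbb{R}^N\times\mathbb{R}^N}\frac{J_p(U(x)-U(y))\,(\varphi(x)-\varphi(y))}{|x-y|^{N+s\,p}}\,dx\,dy=\int_{\mathbb{R}^N}\varphi\,d\mu\qquad\text{for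 every }\varphi\in\mathcal{W}^{s,p}(\mathbb{R}^N).$$ Then $U\in L^\infty(\mathbb{R}^N)$. If $\mu\neq 0$, then for every $z\in\mathbb{R}^N$ the supremum of $|U-U(z)|$ over $\mathbb{R}^N$ is attained at a point of $K$, and $$\|U-U(z)\|_{L^\infty(\mathbb{R}^N)}=\max_K|U-U(z)|.$$ If $\mu=0$ (so that $K=\emptyset$), then $U$ is constant. (2) Let $$\mathfrak{m}_{s,p}(\mathbb{R}^N)=\inf\Big\{[\varphi]^p_{W^{s,p}}\,:\,\varphi\in C^\infty_0(\mathbb{R}^N),\ [\varphi]_{C^{0,\alpha}}=1\Big\}$$ and let $u\in\mathcal{W}^{s,p}(\mathbb{R}^N)$ be an extremal, i.e. $u$ is non-constant and $[u]^p_{W^{s,p}}=\mathfrak{m}_{s,p}(\mathbb{R}^N)\,[u]^p_{C^{0,\alpha}}$. Then $u\in L^\infty(\mathbb{R}^N)$, there are two distinct points $x_0,y_0\in\mathbb{R}^N$, unique up to exchanging them, such that $$[u]_{C^{0,\alpha}}=\frac{|u(x_0)-u(y_0)|}{|x_0-y_0|^{\alpha}},$$ and $$\min\{u(x_0),u(y_0)\}\le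 u(x)\le\max\{u(x_0),u(y_0)\}\qquad\text{for every }x\in\mathbb{R}^N.$$ -/

import Mathlib

open MeasureTheory Set
open scoped ENNReal NNReal

noncomputable section

namespace FracMorrey

/-- The Euclidean space `ℝ^N`. -/
abbrev Rn (N : ℕ) : Type := EuclideanSpace ℝ (Fin N)

/-- The Hölder exponent `α_{s,p} = s - N/p`. -/
def alpha (N : ℕ) (s p : ℝ) : ℝ := s - N / p

/-- The Hölder seminorm `[φ]_{C^{0,α}(ℝ^N)}` with `α = α_{s,p}` (used only for `s p > N`, that is
for `α > 0`), with values in `[0, ∞]`. -/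
def holderSeminorm {N : ℕ} (s p : ℝ) (φ : Rn N → ℝ) : ℝ≥0∞ :=
  eHolderNorm (alpha N s p).toNNReal φ

/-- The `p`-th power `[φ]^p_{W^{s,p}(ℝ^N)}` of the Sobolev-Slobodeckij seminorm, for `0 < s < 1`,
with values in `[0, ∞]`. -/
def slobodeckijPow {N : ℕ} (s p : ℝ) (φ : Rn N → ℝ) : ℝ≥0∞ :=
  ∫⁻ z : Rn N × Rn N,
    ENNReal.ofReal (|φ z.1 - φ z.2| ^ p / ‖z.1 - z.2‖ ^ (N + s * p))

/-- The space `𝒲^{s,p}(ℝ^N)`: continuous functions with finite `C^{0,α_{s,p}}` and `W^{s,p}`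
seminorms. -/
structure MemW {N : ℕ} (s p : ℝ) (φ : Rn N → ℝ) : Prop where
  continuous : Continuous φ
  holder_lt_top : holderSeminorm s p φ < ∞
  slobodeckij_lt_top : slobodeckijPow s p φ < ∞

/-- `J_p(t) = |t|^{p-2} t`. -/
def J (p t : ℝ) : ℝ := |t| ^ (p - 2) * t

/-- The pairing `⟨(-Δ_p)^s U, φ⟩`. For `U, φ ∈ 𝒲^{s,p}(ℝ^N)` the integrand is integrable, by
Hölder's inequality. -/
def fracPLaplacian {N : ℕ} (s p : ℝ) (U φ : Rn N → ℝ) : ℝ :=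
  ∫ z : Rn N × Rn N,
    J p (U z.1 - U z.2) * (φ z.1 - φ z.2) / ‖z.1 - z.2‖ ^ (N + s * p)

/-- The support of a finite signed measure, that is the support of `|μ|`. -/
def signedSupport {N : ℕ} (μ : SignedMeasure (Rn N)) : Set (Rn N) :=
  μ.totalVariation.support

/-- The integral `∫ φ dμ` against a finite signed measure, through its Jordan decomposition. -/
def signedIntegral {N : ℕ} (μ : SignedMeasure (Rn N)) (φ : Rn N → ℝ) : ℝ :=
  ∫ x, φ x ∂μ.toJordanDecomposition.posPart - ∫ x, φ x ∂μ.toJordanDecomposition.negPart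

/-- `U ∈ 𝒲^{s,p}(ℝ^N)` is a weak solution of `(-Δ_p)^s U = μ` in `ℝ^N`. -/
def IsWeakSolution {N : ℕ} (s p : ℝ) (U : Rn N → ℝ) (μ : SignedMeasure (Rn N)) : Prop :=
  MemW s p U ∧ ∀ φ : Rn N → ℝ, MemW s p φ → fracPLaplacian s p U φ = signedIntegral μ φ

/-- The sharp constant `𝔪_{s,p}(ℝ^N)` of the fractional Morrey inequality: the infimum of
`[φ]^p_{W^{s,p}}` among `φ ∈ C^∞_0(ℝ^N)` with `[φ]_{C^{0,α_{s,p}}} = 1`. -/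
def morreyConst (N : ℕ) (s p : ℝ) : ℝ≥0∞ :=
  ⨅ (φ : Rn N → ℝ) (_ : ContDiff ℝ (⊤ : ℕ∞) φ ∧ HasCompactSupport φ ∧ holderSeminorm s p φ = 1),
    slobodeckijPow s p φ

/-- Extremals for `𝔪_{s,p}(ℝ^N)`. -/
structure IsExtremal {N : ℕ} (s p : ℝ) (u : Rn N → ℝ) : Prop where
  memW : MemW s p u
  nonconstant : ¬ ∃ c : ℝ, ∀ x, u x = c
  eq : slobodeckijPow s p u = morreyConst N s p * holderSeminorm s p u ^ p

/-- The Hölder seminorm of `u` is attained at the two distinct points `x`, `y`. -/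
def AttainsHolder {N : ℕ} (s p : ℝ) (u : Rn N → ℝ) (x y : Rn N) : Prop :=
  x ≠ y ∧ holderSeminorm s p u = ENNReal.ofReal (|u x - u y| / ‖x - y‖ ^ alpha N s p)

/-- The Hölder seminorm as a supremum of difference quotients. -/
theorem holderSeminorm_eq_iSup {N : ℕ} {s p : ℝ} (h : 0 < alpha N s p) (φ : Rn N → ℝ) :
    holderSeminorm s p φ =
      ⨆ (x : Rn N) (y : Rn N) (_ : x ≠ y),
        ENNReal.ofReal (|φ x - φ y| / ‖x - y‖ ^ alpha N s p) := by
  have key : ∀ C : ℝ≥0, HolderWith C (alpha N s p).toNNReal φ ↔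
      (⨆ (x : Rn N) (y : Rn N) (_ : x ≠ y),
        ENNReal.ofReal (|φ x - φ y| / ‖x - y‖ ^ alpha N s p)) ≤ C := by
    intro C
    simp only [iSup_le_iff, HolderWith]
    refine forall_congr' fun x => forall_congr' fun y => ?_
    rcases eq_or_ne x y with rfl | hxy
    · simp
    have hd : 0 < ‖x - y‖ := norm_pos_iff.2 (sub_ne_zero.2 hxy)
    rw [Real.coe_toNNReal _ h.le, edist_dist, edist_dist, Real.dist_eq, dist_eq_norm,
      ENNReal.ofReal_rpow_of_pos hd, ← ENNReal.ofReal_coe_nnreal, ← ENNReal.ofReal_mul C.coe_nonneg,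
      ENNReal.ofReal_le_ofReal_iff (by positivity)]
    simp only [hxy, ne_eq, not_false_eq_true, forall_const]
    rw [ENNReal.ofReal_le_ofReal_iff C.coe_nonneg, div_le_iff₀ (by positivity)]
  unfold holderSeminorm eHolderNorm
  simp only [key]
  refine le_antisymm (ENNReal.le_of_forall_nnreal_lt fun r hr => ?_)
    (le_iInf₂ fun C hC => hC)
  by_contra hlt
  push Not at hlt
  obtain ⟨q, h1, h2⟩ := ENNReal.lt_iff_exists_nnreal_btwn.1 hlt
  exact absurd (lt_of_lt_of_le hr (iInf₂_le q h1.le)) (not_lt.2 h2.le)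

end FracMorrey

end

/-! Weak solutions obey a maximum principle because truncations are admissible test functions. With
`M` the maximum of `U` on the support `K`, the function `(U - M)⁺` vanishes on `K`, so the
right-hand side of the tested equation is zero; the left-hand side dominates its Slobodeckij energy
(`rpow_abs_le_J_mul`). A continuous function of zero energy is constant, hence `U ≤ M` everywhere.
Applied also to `-U`, this puts `U` between two values taken on `K`, and the distance to `U z` is
largest at one of them. For `μ = 0` the test function is `U` itself.

For extremals the tool is the sharp Morrey inequality at a fixed pair of points
(`morreyConst_mul_le`), valid for every continuous function: it passes from smooth functions by
mollification, cutoff and truncation, none of which loses a constant in the limit. Attainment is a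
compactness argument: a pair with a large Hölder quotient forces a fixed amount of energy on balls
around its points, while the finite energy leaves little for pairs that are too close, too far apart
or far from the origin. The bounds follow by truncating `u` between its values at an attaining pair:
the quotient there is unchanged, so the energy cannot drop, and all increments must be preserved.
For uniqueness, each attaining pair gives an Euler-Lagrange equation whose left-hand side does not
depend on the pair and whose right-hand side only sees the two points. A bump that sees a single
point of two different pairs gives a contradiction. -/

noncomputable section

namespace FracMorrey

open Filter Topology

variable {N : ℕ} {s p : ℝ}

/-! ### The Slobodeckij seminorm as an `L^p` norm, and the space `𝒲^{s,p}` -/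

/-- The difference quotient whose `L^p` norm is the Slobodeckij seminorm. -/
def kerDiff (s p : ℝ) (φ : Rn N → ℝ) (z : Rn N × Rn N) : ℝ :=
  (φ z.1 - φ z.2) / ‖z.1 - z.2‖ ^ ((N + s * p) / p)

theorem kerDiff_add (φ ψ : Rn N → ℝ) :
    kerDiff s p (fun x => φ x + ψ x) = kerDiff s p φ + kerDiff s p ψ := by
  ext z; simp only [kerDiff, Pi.add_apply]; ring

theorem kerDiff_smul (c : ℝ) (φ : Rn N → ℝ) :
    kerDiff s p (fun x => c * φ x) = c • kerDiff s p φ := by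
  ext z; simp only [kerDiff, Pi.smul_apply, smul_eq_mul]; ring

theorem rpow_div_rpow_self {r : ℝ} (hr : 0 ≤ r) (hp : p ≠ 0) (a : ℝ) : (r ^ (a / p)) ^ p = r ^ a := by
  rw [← Real.rpow_mul hr, div_mul_cancel₀ _ hp]

theorem abs_kerDiff_rpow (hp : p ≠ 0) (φ : Rn N → ℝ) (z : Rn N × Rn N) :
    |kerDiff s p φ z| ^ p = |φ z.1 - φ z.2| ^ p / ‖z.1 - z.2‖ ^ (N + s * p) := by
  have h : 0 ≤ ‖z.1 - z.2‖ ^ ((N + s * p) / p) := by positivity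
  rw [kerDiff, abs_div, abs_of_nonneg h, Real.div_rpow (abs_nonneg _) h,
    rpow_div_rpow_self (norm_nonneg _) hp]

theorem slobodeckijPow_eq_lintegral (hp : 0 < p) (φ : Rn N → ℝ) :
    slobodeckijPow s p φ = ∫⁻ z, ‖kerDiff s p φ z‖ₑ ^ p := by
  refine lintegral_congr fun z => ?_
  rw [← abs_kerDiff_rpow hp.ne', Real.enorm_eq_ofReal_abs,
    ENNReal.ofReal_rpow_of_nonneg (abs_nonneg _) hp.le]

/-- The Slobodeckij seminorm. -/
def slobNorm (s p : ℝ) (φ : Rn N → ℝ) : ℝ≥0∞ := eLpNorm (kerDiff s p φ) (ENNReal.ofReal p) volume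

theorem slobodeckijPow_eq (hp : 0 < p) (φ : Rn N → ℝ) :
    slobodeckijPow s p φ = slobNorm s p φ ^ p := by
  rw [slobodeckijPow_eq_lintegral hp, slobNorm,
    eLpNorm_eq_lintegral_rpow_enorm_toReal (by simpa using hp) (by simp),
    ENNReal.toReal_ofReal hp.le, ← ENNReal.rpow_mul, one_div_mul_cancel hp.ne', ENNReal.rpow_one]

theorem slobNorm_lt_top_iff (hp : 0 < p) (φ : Rn N → ℝ) :
    slobNorm s p φ < ∞ ↔ slobodeckijPow s p φ < ∞ := by
  rw [slobodeckijPow_eq hp, ENNReal.rpow_lt_top_iff_of_pos hp]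

theorem measurable_kerDiff {φ : Rn N → ℝ} (hφ : Continuous φ) : Measurable (kerDiff s p φ) := by
  have h1 : Measurable fun z : Rn N × Rn N => φ z.1 - φ z.2 := by
    exact (by fun_prop : Continuous fun z : Rn N × Rn N => φ z.1 - φ z.2).measurable
  have h2 : Measurable fun z : Rn N × Rn N => ‖z.1 - z.2‖ :=
    (by fun_prop : Continuous fun z : Rn N × Rn N => ‖z.1 - z.2‖).measurable
  exact h1.div (h2.pow_const _)

theorem measurable_slob_integrand {φ : Rn N → ℝ} (hφ : Continuous φ) :
    Measurable fun z : Rn N × Rn N =>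
      ENNReal.ofReal (|φ z.1 - φ z.2| ^ p / ‖z.1 - z.2‖ ^ (N + s * p)) := by
  have h1 : Measurable fun z : Rn N × Rn N => |φ z.1 - φ z.2| :=
    (by fun_prop : Continuous fun z : Rn N × Rn N => |φ z.1 - φ z.2|).measurable
  have h2 : Measurable fun z : Rn N × Rn N => ‖z.1 - z.2‖ :=
    (by fun_prop : Continuous fun z : Rn N × Rn N => ‖z.1 - z.2‖).measurable
  exact ((h1.pow_const _).div (h2.pow_const _)).ennreal_ofReal

theorem slobNorm_add_le (hp : 1 ≤ p) {φ ψ : Rn N → ℝ} (hφ : Continuous φ) (hψ : Continuous ψ) :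
    slobNorm s p (fun x => φ x + ψ x) ≤ slobNorm s p φ + slobNorm s p ψ := by
  unfold slobNorm
  rw [kerDiff_add]
  exact eLpNorm_add_le (measurable_kerDiff hφ).aestronglyMeasurable
    (measurable_kerDiff hψ).aestronglyMeasurable (by simpa using ENNReal.ofReal_le_ofReal hp)

theorem slobNorm_smul (c : ℝ) (φ : Rn N → ℝ) :
    slobNorm s p (fun x => c * φ x) = ‖c‖ₑ * slobNorm s p φ := by
  unfold slobNorm
  rw [kerDiff_smul, eLpNorm_const_smul]

theorem MemW.memLp (hp : 0 < p) {φ : Rn N → ℝ} (h : MemW s p φ) :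
    MemLp (kerDiff s p φ) (ENNReal.ofReal p) volume :=
  ⟨(measurable_kerDiff h.continuous).aestronglyMeasurable,
    (slobNorm_lt_top_iff hp φ).2 h.slobodeckij_lt_top⟩

theorem slobodeckijPow_mono (hp : 0 ≤ p) {φ ψ : Rn N → ℝ}
    (h : ∀ x y, |φ x - φ y| ≤ |ψ x - ψ y|) :
    slobodeckijPow s p φ ≤ slobodeckijPow s p ψ := by
  refine lintegral_mono fun z => ENNReal.ofReal_le_ofReal ?_
  gcongr ?_ ^ p / _
  exact h _ _

theorem holderSeminorm_mono (hα : 0 < alpha N s p) {φ ψ : Rn N → ℝ}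
    (h : ∀ x y, |φ x - φ y| ≤ |ψ x - ψ y|) :
    holderSeminorm s p φ ≤ holderSeminorm s p ψ := by
  rw [holderSeminorm_eq_iSup hα, holderSeminorm_eq_iSup hα]
  exact iSup_mono fun x => iSup_mono fun y => iSup_mono fun _ => ENNReal.ofReal_le_ofReal
    (div_le_div_of_nonneg_right (h x y) (by positivity))

theorem MemW.of_abs_le (hα : 0 < alpha N s p) (hp : 0 ≤ p) {φ ψ : Rn N → ℝ} (hψ : MemW s p ψ)
    (hφ : Continuous φ) (h : ∀ x y, |φ x - φ y| ≤ |ψ x - ψ y|) : MemW s p φ :=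
  ⟨hφ, (holderSeminorm_mono hα h).trans_lt hψ.2, (slobodeckijPow_mono hp h).trans_lt hψ.3⟩

theorem MemW.add (hp : 1 ≤ p) {φ ψ : Rn N → ℝ} (hφ : MemW s p φ) (hψ : MemW s p ψ) :
    MemW s p (fun x => φ x + ψ x) := by
  have hp0 : 0 < p := by linarith
  refine ⟨hφ.1.add hψ.1, eHolderNorm_lt_top.2
    ((eHolderNorm_lt_top.1 hφ.2).add (eHolderNorm_lt_top.1 hψ.2)), ?_⟩
  rw [← slobNorm_lt_top_iff hp0]
  exact (slobNorm_add_le hp hφ.1 hψ.1).trans_lt (ENNReal.add_lt_top.2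
    ⟨(slobNorm_lt_top_iff hp0 _).2 hφ.3, (slobNorm_lt_top_iff hp0 _).2 hψ.3⟩)

theorem MemW.const_mul (hp : 1 ≤ p) {φ : Rn N → ℝ} (hφ : MemW s p φ) (c : ℝ) :
    MemW s p (fun x => c * φ x) := by
  have hp0 : 0 < p := by linarith
  refine ⟨continuous_const.mul hφ.1, eHolderNorm_lt_top.2
    ((eHolderNorm_lt_top.1 hφ.2).smul (c := c)), ?_⟩
  rw [← slobNorm_lt_top_iff hp0, slobNorm_smul]
  exact ENNReal.mul_lt_top enorm_lt_top ((slobNorm_lt_top_iff hp0 _).2 hφ.3)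

/-- Ordered integrands with equal finite integrals agree almost everywhere, and continuity upgrades
this to every pair, since the product volume charges open sets. This rigidity serves both the
maximum principle and the truncation of extremals. -/
theorem abs_sub_eq_of_slobodeckijPow_le (hp : 0 < p) {φ ψ : Rn N → ℝ} (hφ : Continuous φ)
    (hψ : Continuous ψ) (h : ∀ x y, |φ x - φ y| ≤ |ψ x - ψ y|) (hfin : slobodeckijPow s p φ < ∞)
    (hle : slobodeckijPow s p ψ ≤ slobodeckijPow s p φ) (x y : Rn N) :
    |φ x - φ y| = |ψ x - ψ y| := by
  have key := ae_eq_of_ae_le_of_lintegral_le (μ := (volume : Measure (Rn N × Rn N)))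
    (ae_of_all _ fun z => ENNReal.ofReal_le_ofReal
      (show |φ z.1 - φ z.2| ^ p / ‖z.1 - z.2‖ ^ (N + s * p) ≤
        |ψ z.1 - ψ z.2| ^ p / ‖z.1 - z.2‖ ^ (N + s * p) by
        gcongr ?_ ^ p / _; exact h _ _))
    hfin.ne (measurable_slob_integrand hψ).aemeasurable hle
  have h2 : (fun z : Rn N × Rn N => |φ z.1 - φ z.2|) = fun z => |ψ z.1 - ψ z.2| := by
    refine Measure.eq_of_ae_eq (μ := (volume : Measure (Rn N × Rn N))) ?_
      (by fun_prop) (by fun_prop)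
    filter_upwards [key] with z hz
    rcases eq_or_ne z.1 z.2 with e | e
    · simp [e]
    have hd : 0 < ‖z.1 - z.2‖ ^ (N + s * p) := by
      have := norm_pos_iff.2 (sub_ne_zero.2 e)
      positivity
    rw [ENNReal.ofReal_eq_ofReal_iff (by positivity) (by positivity), div_left_inj' hd.ne'] at hz
    exact (Real.rpow_left_inj (abs_nonneg _) (abs_nonneg _) hp.ne').1 hz
  exact congrFun h2 (x, y)

theorem eq_of_slobodeckijPow_eq_zero (hp : 0 < p) {φ : Rn N → ℝ} (hφ : Continuous φ)
    (h0 : slobodeckijPow s p φ = 0) (x y : Rn N) : φ x = φ y := by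
  have := abs_sub_eq_of_slobodeckijPow_le (s := s) hp (φ := fun _ => (0 : ℝ)) continuous_const hφ
    (by simp) (by simp [slobodeckijPow, Real.zero_rpow hp.ne']) (by simp [h0]) x y
  simpa [sub_eq_zero, eq_comm] using this

theorem MemW.exists_holder (hα : 0 < alpha N s p) {φ : Rn N → ℝ} (h : MemW s p φ) (x y : Rn N) :
    |φ x - φ y| ≤ (holderSeminorm s p φ).toReal * ‖x - y‖ ^ alpha N s p := by
  rcases eq_or_ne x y with rfl | hxy
  · simp [Real.zero_rpow hα.ne']
  have hd : 0 < ‖x - y‖ ^ alpha N s p := by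
    have := norm_pos_iff.2 (sub_ne_zero.2 hxy)
    positivity
  rw [← div_le_iff₀ hd, ← ENNReal.ofReal_le_iff_le_toReal h.2.ne, holderSeminorm_eq_iSup hα]
  exact le_iSup_of_le x (le_iSup_of_le y (le_iSup_of_le hxy le_rfl))

theorem alpha_pos (hp : 0 < p) (hsp : (N : ℝ) < s * p) : 0 < alpha N s p := by
  unfold alpha
  rw [sub_pos, div_lt_iff₀ hp]
  exact hsp

/-! ### The nonlinearity `J_p` and the energy pairing -/

theorem abs_J (hp : 1 < p) (t : ℝ) : |J p t| = |t| ^ (p - 1) := by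
  rcases eq_or_ne t 0 with rfl | ht
  · simp [J, Real.zero_rpow (by linarith : p - 1 ≠ 0)]
  · rw [J, abs_mul, abs_of_nonneg (by positivity : 0 ≤ |t| ^ (p - 2)), ← Real.rpow_add_one
      (abs_pos.2 ht).ne']
    congr 1; ring

theorem rpow_sub_one_mul_self (hp : 1 < p) {t : ℝ} (ht : 0 ≤ t) : t ^ (p - 1) * t = t ^ p := by
  rcases ht.eq_or_lt with rfl | ht
  · simp [Real.zero_rpow (by linarith : p ≠ 0)]
  · rw [← Real.rpow_add_one ht.ne']; congr 1; ring

/-- A crude Young inequality, obtained by replacing the smaller of `|a|`, `|b|` by the larger; it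
makes the pairing integrable. -/
theorem abs_J_mul_le (hp : 1 < p) (a b : ℝ) : |J p a * b| ≤ |a| ^ p + |b| ^ p := by
  rw [abs_mul, abs_J hp]
  rcases le_total |b| |a| with h | h
  · calc |a| ^ (p - 1) * |b| ≤ |a| ^ (p - 1) * |a| := by gcongr
      _ = |a| ^ p := rpow_sub_one_mul_self hp (abs_nonneg _)
      _ ≤ _ := le_add_of_nonneg_right (by positivity)
  · calc |a| ^ (p - 1) * |b| ≤ |b| ^ (p - 1) * |b| := by
          gcongr
      _ = |b| ^ p := rpow_sub_one_mul_self hp (abs_nonneg _)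
      _ ≤ _ := le_add_of_nonneg_left (by positivity)

/-- `J p t` has the sign of `t`, so the product equals `|t|^(p-1) |r|`, which is at least `|r|^(p-1)
|r|`. -/
theorem rpow_abs_le_J_mul (hp : 1 < p) {t r : ℝ} (h0 : 0 ≤ t * r) (h1 : |r| ≤ |t|) :
    |r| ^ p ≤ J p t * r := by
  have : J p t * r = |J p t * r| := by
    rw [abs_of_nonneg]
    rw [J, mul_assoc]
    positivity
  rw [this, abs_mul, abs_J hp, ← rpow_sub_one_mul_self hp (abs_nonneg r)]
  gcongr

theorem continuous_J (hp : 1 < p) : Continuous (J p) := by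
  rw [continuous_iff_continuousAt]
  intro t
  rcases eq_or_ne t 0 with rfl | ht
  · have h0 : J p 0 = 0 := by simp [J]
    rw [ContinuousAt, h0]
    -- For `p < 2` the factor `|t|^(p-2)` is singular at `0`; only the product, of size `|t|^(p-1)`,
    -- is controlled.
    refine squeeze_zero_norm (a := fun t => |t| ^ (p - 1))
      (fun t => by rw [Real.norm_eq_abs, abs_J hp]) ?_
    have : Continuous fun t : ℝ => |t| ^ (p - 1) :=
      continuous_abs.rpow_const fun _ => Or.inr (by linarith)
    simpa [Real.zero_rpow (by linarith : p - 1 ≠ 0)] using this.tendsto 0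
  · exact (continuous_abs.continuousAt.rpow_const (Or.inl (by simpa using ht))).mul continuousAt_id

theorem MemW.integrable_slob (hp : 0 < p) {φ : Rn N → ℝ} (hφ : MemW s p φ) :
    Integrable fun z : Rn N × Rn N => |φ z.1 - φ z.2| ^ p / ‖z.1 - z.2‖ ^ (N + s * p) := by
  have := (hφ.memLp hp).integrable_norm_rpow (by simpa using hp) (by simp)
  rw [ENNReal.toReal_ofReal hp.le] at this
  simpa only [Real.norm_eq_abs, abs_kerDiff_rpow hp.ne'] using this

theorem MemW.slobodeckijPow_eq_integral (hp : 0 < p) {φ : Rn N → ℝ} (hφ : MemW s p φ) :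
    slobodeckijPow s p φ = ENNReal.ofReal
      (∫ z : Rn N × Rn N, |φ z.1 - φ z.2| ^ p / ‖z.1 - z.2‖ ^ (N + s * p)) := by
  rw [ofReal_integral_eq_lintegral_ofReal (hφ.integrable_slob hp)
    (ae_of_all _ fun z => by positivity)]
  rfl

theorem measurable_fracPLaplacian_integrand (hp : 1 < p) {U φ : Rn N → ℝ} (hU : Continuous U)
    (hφ : Continuous φ) : Measurable fun z : Rn N × Rn N =>
      J p (U z.1 - U z.2) * (φ z.1 - φ z.2) / ‖z.1 - z.2‖ ^ (N + s * p) := by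
  have h1 : Measurable fun z : Rn N × Rn N => J p (U z.1 - U z.2) * (φ z.1 - φ z.2) :=
    (((continuous_J hp).comp (by fun_prop : Continuous fun z : Rn N × Rn N =>
      U z.1 - U z.2)).mul (by fun_prop)).measurable
  have h2 : Measurable fun z : Rn N × Rn N => ‖z.1 - z.2‖ :=
    (by fun_prop : Continuous fun z : Rn N × Rn N => ‖z.1 - z.2‖).measurable
  exact h1.div (h2.pow_const _)

theorem integrable_fracPLaplacian_integrand (hp : 1 < p) {U φ : Rn N → ℝ} (hU : MemW s p U)
    (hφ : MemW s p φ) : Integrable fun z : Rn N × Rn N =>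
      J p (U z.1 - U z.2) * (φ z.1 - φ z.2) / ‖z.1 - z.2‖ ^ (N + s * p) := by
  have hp0 : 0 < p := by linarith
  refine ((hU.integrable_slob hp0).add (hφ.integrable_slob hp0)).mono'
    (measurable_fracPLaplacian_integrand hp hU.1 hφ.1).aestronglyMeasurable
    (ae_of_all _ fun z => ?_)
  have hd : 0 ≤ ‖z.1 - z.2‖ ^ (N + s * p) := by positivity
  rw [Real.norm_eq_abs, abs_div, abs_of_nonneg hd, Pi.add_apply, ← add_div]
  gcongr
  exact abs_J_mul_le hp _ _

/-- Testing the equation with a monotone `1`-Lipschitz function of the solution. -/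
theorem slobodeckijPow_le_fracPLaplacian (hp : 1 < p) {U φ : Rn N → ℝ} (hU : MemW s p U)
    (hφ : MemW s p φ) (h0 : ∀ x y, 0 ≤ (U x - U y) * (φ x - φ y))
    (h1 : ∀ x y, |φ x - φ y| ≤ |U x - U y|) :
    slobodeckijPow s p φ ≤ ENNReal.ofReal (fracPLaplacian s p U φ) := by
  have hle : ∀ z : Rn N × Rn N, |φ z.1 - φ z.2| ^ p / ‖z.1 - z.2‖ ^ (N + s * p) ≤
      J p (U z.1 - U z.2) * (φ z.1 - φ z.2) / ‖z.1 - z.2‖ ^ (N + s * p) := fun z =>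
    div_le_div_of_nonneg_right (rpow_abs_le_J_mul hp (h0 _ _) (h1 _ _)) (by positivity)
  rw [fracPLaplacian, ofReal_integral_eq_lintegral_ofReal
    (integrable_fracPLaplacian_integrand hp hU hφ)
    (ae_of_all _ fun z => le_trans (by positivity) (hle z))]
  exact lintegral_mono fun z => ENNReal.ofReal_le_ofReal (hle z)

/-! ### Signed measures and the maximum principle -/

theorem signedIntegral_eq_zero {μ : SignedMeasure (Rn N)} {φ : Rn N → ℝ}
    (h : ∀ x ∈ signedSupport μ, φ x = 0) : signedIntegral μ φ = 0 := by
  have hae : ∀ᵐ x ∂μ.totalVariation, φ x = 0 := by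
    filter_upwards [Measure.support_mem_ae (μ := μ.totalVariation)] with x hx using h x hx
  rw [SignedMeasure.totalVariation, ae_add_measure_iff] at hae
  rw [signedIntegral, integral_eq_zero_of_ae hae.1, integral_eq_zero_of_ae hae.2, sub_zero]

theorem signedSupport_nonempty {μ : SignedMeasure (Rn N)} (hμ : μ ≠ 0) :
    (signedSupport μ).Nonempty := by
  refine Measure.nonempty_support fun h => hμ ?_
  ext i _
  exact SignedMeasure.null_of_totalVariation_zero μ (by simp [h])

/-- The test function `(U - M)⁺` vanishes on the support, so its energy is at most `0` and it is
constant. A point of the support identifies the constant as `0`. -/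
theorem IsWeakSolution.le_of_le_on_support (hα : 0 < alpha N s p) (hp : 1 < p)
    {μ : SignedMeasure (Rn N)} {U : Rn N → ℝ} (hU : IsWeakSolution s p U μ) {M : ℝ}
    (hne : (signedSupport μ).Nonempty) (hM : ∀ x ∈ signedSupport μ, U x ≤ M) (x : Rn N) :
    U x ≤ M := by
  have hp0 : 0 < p := by linarith
  have hlip : ∀ x y, |max (U x - M) 0 - max (U y - M) 0| ≤ |U x - U y| := fun x y =>
    (abs_max_sub_max_le_abs _ _ _).trans (by simp)
  have hφ : MemW s p fun x => max (U x - M) 0 :=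
    hU.1.of_abs_le hα hp0.le ((hU.1.1.sub continuous_const).max continuous_const) hlip
  have hle := slobodeckijPow_le_fracPLaplacian hp hU.1 hφ (fun x y => by
    rcases le_total (U x) (U y) with h | h
    · exact mul_nonneg_of_nonpos_of_nonpos (by linarith)
        (sub_nonpos.2 (max_le_max_right _ (by linarith)))
    · exact mul_nonneg (by linarith) (sub_nonneg.2 (max_le_max_right _ (by linarith)))) hlip
  have h0 : ∀ x ∈ signedSupport μ, max (U x - M) 0 = 0 := fun x hx =>
    max_eq_right (by linarith [hM x hx])
  rw [hU.2 _ hφ, signedIntegral_eq_zero h0, ENNReal.ofReal_zero] at hle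
  obtain ⟨y, hy⟩ := hne
  have := eq_of_slobodeckijPow_eq_zero hp0 hφ.1 (le_antisymm hle bot_le) x y
  simp only [h0 y hy] at this
  linarith [le_max_left (U x - M) 0]

theorem signedIntegral_neg (μ : SignedMeasure (Rn N)) (φ : Rn N → ℝ) :
    signedIntegral (-μ) φ = -signedIntegral μ φ := by
  simp [signedIntegral, SignedMeasure.toJordanDecomposition_neg]

theorem signedSupport_neg (μ : SignedMeasure (Rn N)) : signedSupport (-μ) = signedSupport μ := by
  simp [signedSupport, SignedMeasure.totalVariation_neg]

theorem J_neg (t : ℝ) : J p (-t) = -J p t := by simp [J]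

theorem IsWeakSolution.neg (hα : 0 < alpha N s p) (hp : 1 < p)
    {μ : SignedMeasure (Rn N)} {U : Rn N → ℝ} (hU : IsWeakSolution s p U μ) :
    IsWeakSolution s p (fun x => -U x) (-μ) := by
  refine ⟨hU.1.of_abs_le hα (by linarith) hU.1.1.neg fun x y => ?_, fun φ hφ => ?_⟩
  · rw [← abs_neg]; apply le_of_eq; congr 1; ring
  · rw [signedIntegral_neg, ← hU.2 φ hφ, fracPLaplacian, fracPLaplacian, ← integral_neg]
    congr 1
    ext z
    rw [show -U z.1 - -U z.2 = -(U z.1 - U z.2) by ring, J_neg]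
    ring

/-- The essential bound holds on a set that is dense, being of full measure, and closed, by
continuity; so it holds at the maximum point too. -/
theorem eLpNorm_top_eq_of_isMaxOn {f : Rn N → ℝ} (hf : Continuous f) {x₀ : Rn N}
    (h : IsMaxOn (fun x => |f x|) univ x₀) :
    eLpNorm f ∞ volume = ENNReal.ofReal |f x₀| := by
  refine le_antisymm ?_ ?_
  · rw [eLpNorm_exponent_top]
    refine eLpNormEssSup_le_of_ae_bound (ae_of_all _ fun x => ?_)
    exact h (mem_univ x)
  · have hd : Dense {x | ‖f x‖ₑ ≤ eLpNorm f ∞ volume} := Measure.dense_of_ae (by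
      rw [eLpNorm_exponent_top]; exact enorm_ae_le_eLpNormEssSup f volume)
    have hc : IsClosed {x | ‖f x‖ₑ ≤ eLpNorm f ∞ volume} :=
      isClosed_le (by fun_prop) continuous_const
    have := hd.closure_eq
    rw [hc.closure_eq] at this
    rw [← Real.enorm_eq_ofReal_abs]
    exact (eq_univ_iff_forall.1 this) x₀

theorem memLp_top_of_bounded {f : Rn N → ℝ} (hf : Continuous f) {a b : ℝ}
    (h : ∀ x, a ≤ f x ∧ f x ≤ b) : MemLp f ∞ volume :=
  memLp_top_of_bound hf.aestronglyMeasurable (max |a| |b|) (ae_of_all _ fun x =>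
    abs_le_max_abs_abs (h x).1 (h x).2)

theorem IsWeakSolution.const_of_eq_zero (hp : 1 < p) {U : Rn N → ℝ}
    (hU : IsWeakSolution s p U 0) (x y : Rn N) : U x = U y := by
  have hle := slobodeckijPow_le_fracPLaplacian hp hU.1 hU.1 (fun x y => mul_self_nonneg _)
    fun _ _ => le_rfl
  rw [hU.2 U hU.1, signedIntegral_eq_zero (by
    simp [signedSupport, SignedMeasure.totalVariation_zero, Measure.support_zero]),
    ENNReal.ofReal_zero] at hle
  exact eq_of_slobodeckijPow_eq_zero (by linarith) hU.1.1 (le_antisymm hle bot_le) x y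

theorem IsWeakSolution.exists_bounds (hα : 0 < alpha N s p) (hp : 1 < p)
    {μ : SignedMeasure (Rn N)} {U : Rn N → ℝ} (hU : IsWeakSolution s p U μ) (hμ : μ ≠ 0)
    (hK : IsCompact (signedSupport μ)) :
    ∃ a ∈ signedSupport μ, ∃ b ∈ signedSupport μ, ∀ x, U a ≤ U x ∧ U x ≤ U b := by
  have hne := signedSupport_nonempty hμ
  obtain ⟨b, hb, hbmax⟩ := hK.exists_isMaxOn hne hU.1.1.continuousOn
  obtain ⟨a, ha, hamin⟩ := hK.exists_isMinOn hne hU.1.1.continuousOn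
  refine ⟨a, ha, b, hb, fun x => ⟨?_, hU.le_of_le_on_support hα hp hne (fun y hy => hbmax hy) x⟩⟩
  refine neg_le_neg_iff.1 ((hU.neg hα hp).le_of_le_on_support hα hp
    (by rwa [signedSupport_neg]) (fun y hy => neg_le_neg ?_) x)
  rw [signedSupport_neg] at hy
  exact hamin hy

/-- The maximum principle for weak solutions with compactly supported right-hand side. -/
theorem IsWeakSolution.maximum_principle (hα : 0 < alpha N s p) (hp : 1 < p)
    {μ : SignedMeasure (Rn N)} {U : Rn N → ℝ} (hK : IsCompact (signedSupport μ))
    (hU : IsWeakSolution s p U μ) :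
    MemLp U ∞ volume ∧
      (μ ≠ 0 → ∀ z : Rn N, ∃ x₀ ∈ signedSupport μ,
        IsMaxOn (fun x => |U x - U z|) univ x₀ ∧
        eLpNorm (fun x => U x - U z) ∞ volume = ENNReal.ofReal |U x₀ - U z|) ∧
      (μ = 0 → ∀ x y : Rn N, U x = U y) := by
  refine ⟨?_, fun hμ z => ?_, fun hμ => by subst hμ; exact hU.const_of_eq_zero hp⟩
  · by_cases hμ : μ = 0
    · subst hμ
      exact memLp_top_of_bounded hU.1.1 fun x =>
        ⟨(hU.const_of_eq_zero hp 0 x).le, (hU.const_of_eq_zero hp x 0).le⟩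
    · obtain ⟨a, -, b, -, hab⟩ := hU.exists_bounds hα hp hμ hK
      exact memLp_top_of_bounded hU.1.1 hab
  · obtain ⟨a, ha, b, hb, hab⟩ := hU.exists_bounds hα hp hμ hK
    obtain ⟨x₀, hx₀, hmax⟩ : ∃ x₀ ∈ signedSupport μ, IsMaxOn (fun x => |U x - U z|) univ x₀ := by
      have h : ∀ x, |U x - U z| ≤ max |U a - U z| |U b - U z| := fun x =>
        abs_le_max_abs_abs (by linarith [(hab x).1]) (by linarith [(hab x).2])
      rcases le_total |U a - U z| |U b - U z| with h' | h'
      · exact ⟨b, hb, fun x _ => (h x).trans (max_eq_right h').le⟩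
      · exact ⟨a, ha, fun x _ => (h x).trans (max_eq_left h').le⟩
    exact ⟨x₀, hx₀, hmax, eLpNorm_top_eq_of_isMaxOn (hU.1.1.sub continuous_const) hmax⟩

/-! ### Smooth compactly supported functions lie in `𝒲^{s,p}` -/

/-- In polar coordinates the radial integrand is `r^(p - s p - 1)` near `0`, integrable since `s <
1`, and `r^(-1 - s p)` at infinity, integrable since `s > 0`. -/
theorem integrable_min_rpow_div (hN : 1 ≤ N) (hs0 : 0 < s) (hs1 : s < 1) (hp : 0 < p) :
    Integrable fun h : Rn N => min ‖h‖ 1 ^ p / ‖h‖ ^ (N + s * p) := by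
  have : Nonempty (Fin N) := ⟨⟨0, hN⟩⟩
  rw [integrable_fun_norm_addHaar (volume : Measure (Rn N))
    (f := fun r : ℝ => min r 1 ^ p / r ^ (N + s * p)), ← Ioc_union_Ioi_eq_Ioi zero_le_one]
  have hdim : Module.finrank ℝ (Rn N) = N := by simp
  have hpow : ∀ y : ℝ, 0 < y → y ^ (N - 1) = y ^ ((N : ℝ) - 1) := fun y hy => by
    rw [← Real.rpow_natCast, Nat.cast_sub hN, Nat.cast_one]
  refine IntegrableOn.union ?_ ?_
  · have h1 : IntegrableOn (fun y : ℝ => y ^ (p - s * p - 1)) (Ioc 0 1) := by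
      rw [← intervalIntegrable_iff_integrableOn_Ioc_of_le zero_le_one]
      exact intervalIntegral.intervalIntegrable_rpow' (by nlinarith)
    refine h1.congr_fun (fun y hy => ?_) measurableSet_Ioc
    simp only [hdim, smul_eq_mul]
    rw [min_eq_left hy.2, hpow y hy.1, ← Real.rpow_sub hy.1, ← Real.rpow_add hy.1]
    congr 1; ring
  · have h1 : IntegrableOn (fun y : ℝ => y ^ (-1 - s * p)) (Ioi 1) :=
      integrableOn_Ioi_rpow_of_lt (by nlinarith) one_pos
    refine h1.congr_fun (fun y hy => ?_) measurableSet_Ioi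
    have hy0 : (0 : ℝ) < y := one_pos.trans hy
    simp only [hdim, smul_eq_mul]
    rw [min_eq_right (le_of_lt hy), hpow y hy0, Real.one_rpow, one_div, ← Real.rpow_neg hy0.le,
      ← Real.rpow_add hy0]
    congr 1; ring

/-- The integrand is at most `g (x - y)` and vanishes unless `x` or `y` lies in the support `S`.
Tonelli, in the order suited to each case, bounds the energy by `2 |S| ∫ g`. -/
theorem slobodeckijPow_lt_top_of_lipschitz (hN : 1 ≤ N) (hs0 : 0 < s) (hs1 : s < 1) (hp : 0 < p)
    {φ : Rn N → ℝ} {C : ℝ} (hC : ∀ x y, |φ x - φ y| ≤ C * min ‖x - y‖ 1)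
    (hsupp : HasCompactSupport φ) : slobodeckijPow s p φ < ∞ := by
  set S := tsupport φ with hS
  have hSm : MeasurableSet S := (isClosed_tsupport φ).measurableSet
  have hSfin : volume S < ∞ := hsupp.isCompact.measure_lt_top
  set g : Rn N → ℝ≥0∞ := fun h => ENNReal.ofReal (C ^ p * (min ‖h‖ 1 ^ p / ‖h‖ ^ (N + s * p)))
    with hg
  have hgm : Measurable g := by
    have h2 : Measurable fun z : Rn N => ‖z‖ := measurable_norm
    exact ((((h2.min measurable_const).pow_const _).div (h2.pow_const _)).const_mul _).ennreal_ofReal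
  have hgfin : ∫⁻ h, g h < ∞ :=
    ((integrable_min_rpow_div hN hs0 hs1 hp).const_mul (C ^ p)).lintegral_lt_top
  -- No sign of `C` is assumed; a negative `C` forces `φ` to be constant.
  have hC0 : 0 ≤ C ∨ ∀ x y, φ x = φ y := by
    by_contra! h
    obtain ⟨hC0, x, y, hxy⟩ := h
    have h1 := hC x y
    have h2 : 0 < |φ x - φ y| := abs_pos.2 (sub_ne_zero.2 hxy)
    have h3 : 0 ≤ min ‖x - y‖ 1 := by positivity
    nlinarith
  rcases hC0 with hC0 | hconst
  swap
  · have : slobodeckijPow s p φ = 0 := by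
      simp [slobodeckijPow, hconst _ 0, Real.zero_rpow hp.ne']
    simp [this]
  have hbound : ∀ z : Rn N × Rn N,
      ENNReal.ofReal (|φ z.1 - φ z.2| ^ p / ‖z.1 - z.2‖ ^ (N + s * p)) ≤
        S.indicator 1 z.1 * g (z.1 - z.2) + S.indicator 1 z.2 * g (z.1 - z.2) := by
    intro z
    have hb : ENNReal.ofReal (|φ z.1 - φ z.2| ^ p / ‖z.1 - z.2‖ ^ (N + s * p)) ≤
        g (z.1 - z.2) := by
      refine ENNReal.ofReal_le_ofReal ?_
      rw [← mul_div_assoc, ← Real.mul_rpow hC0 (by positivity)]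
      gcongr ?_ ^ p / _
      exact hC _ _
    by_cases h1 : z.1 ∈ S
    · simp only [indicator_of_mem h1, Pi.one_apply, one_mul]
      exact hb.trans le_self_add
    by_cases h2 : z.2 ∈ S
    · simp only [indicator_of_mem h2, Pi.one_apply, one_mul]
      exact hb.trans le_add_self
    · simp [image_eq_zero_of_notMem_tsupport h1, image_eq_zero_of_notMem_tsupport h2,
        Real.zero_rpow hp.ne']
  have hind : Measurable (S.indicator (1 : Rn N → ℝ≥0∞)) := measurable_one.indicator hSm
  refine (lintegral_mono hbound).trans_lt ?_
  have hm1 : Measurable fun z : Rn N × Rn N => S.indicator 1 z.1 * g (z.1 - z.2) :=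
    (hind.comp measurable_fst).mul (hgm.comp (measurable_fst.sub measurable_snd))
  have hm2 : Measurable fun z : Rn N × Rn N => S.indicator 1 z.2 * g (z.1 - z.2) :=
    (hind.comp measurable_snd).mul (hgm.comp (measurable_fst.sub measurable_snd))
  rw [lintegral_add_left hm1, Measure.volume_eq_prod, lintegral_prod _ hm1.aemeasurable,
    lintegral_prod_symm _ hm2.aemeasurable]
  have e1 : ∀ x : Rn N, ∫⁻ y, S.indicator 1 x * g (x - y) = S.indicator 1 x * ∫⁻ h, g h :=
    fun x => by
      have hm : Measurable fun y => g (x - y) := hgm.comp (measurable_const.sub measurable_id)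
      rw [lintegral_const_mul _ hm, lintegral_sub_left_eq_self g x]
  have e2 : ∀ y : Rn N, ∫⁻ x, S.indicator 1 y * g (x - y) = S.indicator 1 y * ∫⁻ h, g h :=
    fun y => by
      have hm : Measurable fun x => g (x - y) := hgm.comp (measurable_id.sub measurable_const)
      rw [lintegral_const_mul _ hm, lintegral_sub_right_eq_self g y]
  simp only [e1, e2]
  rw [lintegral_mul_const _ hind, lintegral_indicator_one hSm]
  exact ENNReal.add_lt_top.2 ⟨ENNReal.mul_lt_top hSfin hgfin, ENNReal.mul_lt_top hSfin hgfin⟩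

theorem exists_lipschitz_min {φ : Rn N → ℝ} (hφ : ContDiff ℝ (⊤ : ℕ∞) φ)
    (hsupp : HasCompactSupport φ) : ∃ C : ℝ, 0 ≤ C ∧ ∀ x y, |φ x - φ y| ≤ C * min ‖x - y‖ 1 := by
  obtain ⟨L, hL⟩ := hφ.lipschitzWith_of_hasCompactSupport hsupp (by simp)
  obtain ⟨B, hB⟩ := hsupp.exists_bound_of_continuous hφ.continuous
  have hB0 : 0 ≤ B := (norm_nonneg _).trans (hB 0)
  refine ⟨L + 2 * B, by positivity, fun x y => ?_⟩
  rcases le_total ‖x - y‖ 1 with h | h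
  · rw [min_eq_left h]
    have := hL.dist_le_mul x y
    rw [Real.dist_eq, dist_eq_norm] at this
    nlinarith [norm_nonneg (x - y)]
  · rw [min_eq_right h]
    have h1 := hB x
    have h2 := hB y
    rw [Real.norm_eq_abs] at h1 h2
    have := abs_sub (φ x) (φ y)
    have := L.coe_nonneg
    linarith

theorem memW_of_contDiff (hN : 1 ≤ N) (hs0 : 0 < s) (hs1 : s < 1) (hp : 0 < p)
    (hα : 0 < alpha N s p) {φ : Rn N → ℝ} (hφ : ContDiff ℝ (⊤ : ℕ∞) φ)
    (hsupp : HasCompactSupport φ) : MemW s p φ := by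
  obtain ⟨C, hC0, hC⟩ := exists_lipschitz_min hφ hsupp
  refine ⟨hφ.continuous, ?_, slobodeckijPow_lt_top_of_lipschitz hN hs0 hs1 hp hC hsupp⟩
  have hα1 : alpha N s p ≤ 1 := by
    have : 0 ≤ (N : ℝ) / p := by positivity
    unfold alpha; linarith
  rw [holderSeminorm_eq_iSup hα]
  refine (iSup_le fun x => iSup_le fun y => iSup_le fun hxy => ?_ : _ ≤ ENNReal.ofReal C).trans_lt
    ENNReal.ofReal_lt_top
  have hd : 0 < ‖x - y‖ := norm_pos_iff.2 (sub_ne_zero.2 hxy)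
  refine ENNReal.ofReal_le_ofReal ?_
  rw [div_le_iff₀ (by positivity)]
  refine (hC x y).trans ?_
  gcongr
  rcases le_total ‖x - y‖ 1 with h | h
  · rw [min_eq_left h]
    conv_lhs => rw [← Real.rpow_one ‖x - y‖]
    exact Real.rpow_le_rpow_of_exponent_ge hd h hα1
  · rw [min_eq_right h]
    exact Real.one_le_rpow h hα.le

/-! ### Dilation, cutoff and mollification -/

theorem slobodeckijPow_comp_smul {φ : Rn N → ℝ} (hφ : Continuous φ) {c : ℝ} (hc : 0 < c) :
    slobodeckijPow s p (fun x => φ (c • x)) =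
      ENNReal.ofReal (c ^ (s * p - N)) * slobodeckijPow s p φ := by
  have hdim : Module.finrank ℝ (Rn N × Rn N) = 2 * N := by simp; ring
  have hm := measurable_slob_integrand (s := s) (p := p) hφ
  have h1 : ∀ z : Rn N × Rn N,
      ENNReal.ofReal (|φ (c • z.1) - φ (c • z.2)| ^ p / ‖z.1 - z.2‖ ^ (N + s * p)) =
      ENNReal.ofReal (c ^ (N + s * p)) * ENNReal.ofReal
        (|φ (c • z).1 - φ (c • z).2| ^ p / ‖(c • z).1 - (c • z).2‖ ^ (N + s * p)) := fun z => by
    rw [← ENNReal.ofReal_mul (by positivity), Prod.smul_fst, Prod.smul_snd, ← smul_sub, norm_smul,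
      Real.norm_of_nonneg hc.le, Real.mul_rpow hc.le (norm_nonneg _)]
    congr 1
    have : c ^ (N + s * p) ≠ 0 := by positivity
    field_simp
  have hm' : Measurable fun z : Rn N × Rn N => ENNReal.ofReal
      (|φ (c • z).1 - φ (c • z).2| ^ p / ‖(c • z).1 - (c • z).2‖ ^ (N + s * p)) :=
    hm.comp (measurable_const_smul c : Measurable fun z : Rn N × Rn N => c • z)
  have h2 := lintegral_map hm (measurable_const_smul c : Measurable fun z : Rn N × Rn N => c • z)
    (μ := volume)
  have : (volume : Measure (Rn N × Rn N)).IsAddHaarMeasure := by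
    rw [Measure.volume_eq_prod]; infer_instance
  rw [Measure.map_addHaar_smul volume hc.ne', lintegral_smul_measure, hdim] at h2
  rw [slobodeckijPow, lintegral_congr h1, lintegral_const_mul _ hm', ← h2,
    smul_eq_mul, ← mul_assoc, ← ENNReal.ofReal_mul (by positivity), slobodeckijPow]
  congr 2
  rw [abs_of_nonneg (by positivity), ← Real.rpow_natCast, ← Real.rpow_neg hc.le, ← Real.rpow_add hc]
  congr 1; push_cast; ring

/-- The energy scales like `c^(s p - N)` under `x ↦ c x`, with positive exponent: wide cutoffs cost
arbitrarily little. -/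
theorem tendsto_slobodeckijPow_comp_smul (hsp : (N : ℝ) < s * p) {φ : Rn N → ℝ}
    (hφ : Continuous φ) (hfin : slobodeckijPow s p φ < ∞) :
    Tendsto (fun n : ℕ => slobodeckijPow s p (fun x => φ ((1 / ((n : ℝ) + 1)) • x))) atTop (𝓝 0) := by
  have h0 : Tendsto (fun n : ℕ => (1 / ((n : ℝ) + 1)) ^ (s * p - N)) atTop (𝓝 0) := by
    have := (tendsto_one_div_add_atTop_nhds_zero_nat (𝕜 := ℝ)).rpow_const
      (p := s * p - N) (Or.inr (by linarith))
    rwa [Real.zero_rpow (by linarith)] at this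
  have h1 := ENNReal.Tendsto.mul_const (ENNReal.tendsto_ofReal h0) (Or.inr hfin.ne)
  rw [ENNReal.ofReal_zero, zero_mul] at h1
  refine h1.congr fun n => ?_
  rw [slobodeckijPow_comp_smul hφ (by positivity)]

/-- Discrete Leibniz rule followed by Minkowski. The coefficient `1` of `slobNorm s p φ` keeps the
sharp constant when the cutoff energy tends to `0`. -/
theorem slobNorm_mul_le (hp : 1 ≤ p) {η φ : Rn N → ℝ} (hη : Continuous η) (hφ : Continuous φ)
    {b : ℝ} (hη1 : ∀ x, |η x| ≤ 1) (hb : ∀ x, |φ x| ≤ b) :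
    slobNorm s p (fun x => η x * φ x) ≤ slobNorm s p φ + ENNReal.ofReal b * slobNorm s p η := by
  have hb0 : 0 ≤ b := (abs_nonneg _).trans (hb 0)
  have hdec : kerDiff s p (fun x => η x * φ x) =
      (fun z => η z.1 * kerDiff s p φ z) + fun z => φ z.2 * kerDiff s p η z := by
    ext z; simp only [kerDiff, Pi.add_apply]; ring
  have e : ENNReal.ofReal b * slobNorm s p η = slobNorm s p (fun x => b * η x) := by
    rw [slobNorm_smul, Real.enorm_eq_ofReal_abs, abs_of_nonneg hb0]
  rw [e]
  unfold slobNorm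
  rw [hdec]
  have hm1 : Measurable fun z : Rn N × Rn N => η z.1 * kerDiff s p φ z :=
    (hη.measurable.comp measurable_fst).mul (measurable_kerDiff hφ)
  have hm2 : Measurable fun z : Rn N × Rn N => φ z.2 * kerDiff s p η z :=
    (hφ.measurable.comp measurable_snd).mul (measurable_kerDiff hη)
  refine (eLpNorm_add_le hm1.aestronglyMeasurable hm2.aestronglyMeasurable
    (by simpa using ENNReal.ofReal_le_ofReal hp)).trans (add_le_add ?_ ?_)
  · refine eLpNorm_mono fun z => ?_
    rw [norm_mul]
    exact mul_le_of_le_one_left (norm_nonneg _) (hη1 _)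
  · refine eLpNorm_mono fun z => ?_
    rw [kerDiff_smul, Pi.smul_apply, smul_eq_mul, norm_mul, norm_mul, Real.norm_of_nonneg hb0]
    gcongr
    exact hb _

theorem slobodeckijPow_comp_sub {φ : Rn N → ℝ} (t : Rn N) :
    slobodeckijPow s p (fun x => φ (x - t)) = slobodeckijPow s p φ := by
  have : (volume : Measure (Rn N × Rn N)).IsAddHaarMeasure := by
    rw [Measure.volume_eq_prod]; infer_instance
  have h := lintegral_sub_right_eq_self (μ := (volume : Measure (Rn N × Rn N))) (fun z =>
    ENNReal.ofReal (|φ z.1 - φ z.2| ^ p / ‖z.1 - z.2‖ ^ (N + s * p))) (t, t)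
  rw [slobodeckijPow, slobodeckijPow, ← h]
  simp

/-- Averaging translates decreases the Slobodeckij seminorm. -/
theorem slobodeckijPow_average_le (hp : 1 ≤ p) {φ : Rn N → ℝ} (hφ : Continuous φ)
    {b : ℝ} (hb : ∀ x, |φ x| ≤ b) (P : Measure (Rn N)) [IsProbabilityMeasure P] :
    slobodeckijPow s p (fun x => ∫ t, φ (x - t) ∂P) ≤ slobodeckijPow s p φ := by
  have hp0 : 0 < p := by linarith
  have hint : ∀ x, Integrable (fun t => φ (x - t)) P := fun x =>
    Integrable.of_bound (by fun_prop : Continuous fun t => φ (x - t)).aestronglyMeasurable b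
      (ae_of_all _ fun t => hb _)
  have hker : ∀ z : Rn N × Rn N, ‖kerDiff s p (fun x => ∫ t, φ (x - t) ∂P) z‖ₑ ^ p ≤
      ∫⁻ t, ‖kerDiff s p (fun x => φ (x - t)) z‖ₑ ^ p ∂P := by
    intro z
    have e : kerDiff s p (fun x => ∫ t, φ (x - t) ∂P) z =
        ∫ t, kerDiff s p (fun x => φ (x - t)) z ∂P := by
      simp only [kerDiff]
      rw [integral_div, integral_sub (hint _) (hint _)]
    have hmeas : AEStronglyMeasurable (fun t => kerDiff s p (fun x => φ (x - t)) z) P := by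
      have : Continuous fun t => kerDiff s p (fun x => φ (x - t)) z := by
        simp only [kerDiff]; fun_prop
      exact this.aestronglyMeasurable
    -- Jensen, in the form `L^1 ≤ L^p` on a probability space.
    have h1 := eLpNorm_le_eLpNorm_of_exponent_le (μ := P) (p := 1) (q := ENNReal.ofReal p)
      (by simpa using ENNReal.ofReal_le_ofReal hp) hmeas
    rw [eLpNorm_one_eq_lintegral_enorm, eLpNorm_eq_lintegral_rpow_enorm_toReal (by simpa using hp0)
      (by simp), ENNReal.toReal_ofReal hp0.le] at h1
    rw [e]
    calc _ ≤ ((∫⁻ t, ‖kerDiff s p (fun x => φ (x - t)) z‖ₑ ^ p ∂P) ^ (1 / p)) ^ p := by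
          gcongr
          exact (enorm_integral_le_lintegral_enorm _).trans h1
      _ = _ := by rw [← ENNReal.rpow_mul, one_div_mul_cancel hp0.ne', ENNReal.rpow_one]
  rw [slobodeckijPow_eq_lintegral hp0]
  refine (lintegral_mono hker).trans ?_
  rw [lintegral_lintegral_swap]
  · have : ∀ t, ∫⁻ z, ‖kerDiff s p (fun x => φ (x - t)) z‖ₑ ^ p = slobodeckijPow s p φ := fun t => by
      rw [← slobodeckijPow_eq_lintegral hp0, slobodeckijPow_comp_sub]
    simp [this]
  · have h1 : Measurable fun q : (Rn N × Rn N) × Rn N => φ (q.1.1 - q.2) - φ (q.1.2 - q.2) :=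
      (by fun_prop : Continuous fun q : (Rn N × Rn N) × Rn N =>
        φ (q.1.1 - q.2) - φ (q.1.2 - q.2)).measurable
    have h2 : Measurable fun q : (Rn N × Rn N) × Rn N => ‖q.1.1 - q.1.2‖ :=
      (by fun_prop : Continuous fun q : (Rn N × Rn N) × Rn N => ‖q.1.1 - q.1.2‖).measurable
    exact ((h1.div (h2.pow_const _)).enorm.pow_const _).aemeasurable

open scoped Convolution in
/-- Mollification of a compactly supported continuous function. -/
theorem exists_smooth_approx (hp : 1 ≤ p) {φ : Rn N → ℝ} (hφ : Continuous φ)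
    (hsupp : HasCompactSupport φ) :
    ∃ ψ : ℕ → Rn N → ℝ, (∀ n, ContDiff ℝ (⊤ : ℕ∞) (ψ n)) ∧ (∀ n, HasCompactSupport (ψ n)) ∧
      (∀ n, slobodeckijPow s p (ψ n) ≤ slobodeckijPow s p φ) ∧
      ∀ x, Tendsto (fun n => ψ n x) atTop (𝓝 (φ x)) := by
  obtain ⟨b, hb⟩ := hsupp.exists_bound_of_continuous hφ
  let ρ : ℕ → ContDiffBump (0 : Rn N) := fun n =>
    ⟨1 / ((n : ℝ) + 1), 2 * (1 / ((n : ℝ) + 1)), by positivity, by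
      have : 0 < 1 / ((n : ℝ) + 1) := by positivity
      linarith⟩
  have hρ : Tendsto (fun n => (ρ n).rOut) atTop (𝓝 0) := by
    have := (tendsto_one_div_add_atTop_nhds_zero_nat (𝕜 := ℝ)).const_mul 2
    rw [mul_zero] at this
    exact this
  refine ⟨fun n => (ρ n).normed volume ⋆[ContinuousLinearMap.lsmul ℝ ℝ, volume] φ, fun n => ?_,
    fun n => ?_, fun n => ?_, fun x => ?_⟩
  · exact (ρ n).hasCompactSupport_normed.contDiff_convolution_left _ (ρ n).contDiff_normed
      hφ.locallyIntegrable
  · exact (ρ n).hasCompactSupport_normed.convolution _ hsupp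
  · set r : Rn N → ℝ≥0 := fun t => ((ρ n).normed volume t).toNNReal with hr
    have hrm : Measurable r := (ρ n).continuous_normed.measurable.real_toNNReal
    -- The normalized bump is a probability density, so the convolution is an average of translates.
    have hP : IsProbabilityMeasure (volume.withDensity fun t => (r t : ℝ≥0∞)) := ⟨by
      rw [withDensity_apply _ MeasurableSet.univ, Measure.restrict_univ]
      change ∫⁻ t, ENNReal.ofReal ((ρ n).normed volume t) = 1
      rw [← ofReal_integral_eq_lintegral_ofReal (ρ n).integrable_normed
        (ae_of_all _ fun t => (ρ n).nonneg_normed t), (ρ n).integral_normed, ENNReal.ofReal_one]⟩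
    have e : ((ρ n).normed volume ⋆[ContinuousLinearMap.lsmul ℝ ℝ, volume] φ) =
        fun x => ∫ t, φ (x - t) ∂(volume.withDensity fun t => (r t : ℝ≥0∞)) := by
      ext x
      rw [integral_withDensity_eq_integral_smul hrm]
      refine integral_congr_ae (ae_of_all _ fun t => ?_)
      simp [hr, NNReal.smul_def, (ρ n).nonneg_normed t]
    beta_reduce
    rw [e]
    exact slobodeckijPow_average_le hp hφ hb _
  · exact ContDiffBump.convolution_tendsto_right_of_continuous hρ hφ x

/-! ### The sharp Morrey inequality for continuous functions -/

/-- The Hölder difference quotient. -/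
def holderQuot (s p : ℝ) (φ : Rn N → ℝ) (x y : Rn N) : ℝ := |φ x - φ y| / ‖x - y‖ ^ alpha N s p

theorem holderQuot_nonneg (φ : Rn N → ℝ) (x y : Rn N) : 0 ≤ holderQuot s p φ x y := by
  unfold holderQuot; positivity

theorem ofReal_holderQuot_le (hα : 0 < alpha N s p) (φ : Rn N → ℝ) {x y : Rn N} (hxy : x ≠ y) :
    ENNReal.ofReal (holderQuot s p φ x y) ≤ holderSeminorm s p φ := by
  rw [holderSeminorm_eq_iSup hα]
  exact le_iSup_of_le x (le_iSup_of_le y (le_iSup_of_le hxy le_rfl))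

/-- At a fixed pair of points, pointwise convergence suffices to pass to the limit; no convergence
of Hölder seminorms is needed. -/
theorem tendsto_ofReal_holderQuot_rpow {ψ : ℕ → Rn N → ℝ} {φ : Rn N → ℝ}
    {x y : Rn N} (hx : Tendsto (fun n => ψ n x) atTop (𝓝 (φ x)))
    (hy : Tendsto (fun n => ψ n y) atTop (𝓝 (φ y))) {m : ℝ≥0∞} (hm : m ≠ ∞) :
    Tendsto (fun n => m * ENNReal.ofReal (holderQuot s p (ψ n) x y) ^ p) atTop
      (𝓝 (m * ENNReal.ofReal (holderQuot s p φ x y) ^ p)) := by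
  refine ENNReal.Tendsto.const_mul ?_ (Or.inr hm)
  refine ((ENNReal.continuous_rpow_const (y := p)).tendsto _).comp (ENNReal.tendsto_ofReal ?_)
  exact (hx.sub hy).abs.div_const _

theorem slobodeckijPow_const_mul (hp : 0 < p) (c : ℝ) (φ : Rn N → ℝ) :
    slobodeckijPow s p (fun x => c * φ x) = ‖c‖ₑ ^ p * slobodeckijPow s p φ := by
  rw [slobodeckijPow_eq hp, slobodeckijPow_eq hp, slobNorm_smul, ENNReal.mul_rpow_of_nonneg _ _ hp.le]

theorem morreyConst_mul_le_of_contDiff (hN : 1 ≤ N) (hs0 : 0 < s) (hs1 : s < 1) (hp : 0 < p)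
    (hα : 0 < alpha N s p) {ψ : Rn N → ℝ} (hψ : ContDiff ℝ (⊤ : ℕ∞) ψ)
    (hsupp : HasCompactSupport ψ) :
    morreyConst N s p * holderSeminorm s p ψ ^ p ≤ slobodeckijPow s p ψ := by
  have hfin := (memW_of_contDiff hN hs0 hs1 hp hα hψ hsupp).2
  set H := holderSeminorm s p ψ with hH
  rcases eq_or_ne H 0 with h0 | h0
  · simp [h0, ENNReal.zero_rpow_of_pos hp]
  have hpos : 0 < H.toReal := ENNReal.toReal_pos h0 hfin.ne
  have he : ‖H.toReal⁻¹‖ₑ = H⁻¹ := by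
    rw [enorm_inv hpos.ne', Real.enorm_eq_ofReal hpos.le, ENNReal.ofReal_toReal hfin.ne]
  have h1 : holderSeminorm s p (fun x => H.toReal⁻¹ * ψ x) = 1 := by
    have : holderSeminorm s p (fun x => H.toReal⁻¹ * ψ x) = ‖H.toReal⁻¹‖ₑ * H := by
      exact eHolderNorm_smul (f := ψ) H.toReal⁻¹
    rw [this, he, ENNReal.inv_mul_cancel h0 hfin.ne]
  have h2 : morreyConst N s p ≤ slobodeckijPow s p (fun x => H.toReal⁻¹ * ψ x) :=
    iInf₂_le _ ⟨contDiff_const.mul hψ, hsupp.mul_left, h1⟩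
  rw [slobodeckijPow_const_mul hp, he, ENNReal.inv_rpow, mul_comm, ← div_eq_mul_inv] at h2
  exact (ENNReal.le_div_iff_mul_le (Or.inl (by simp [h0, hp.le])) (Or.inl
    (ENNReal.rpow_ne_top_of_nonneg hp.le hfin.ne))).1 h2

theorem morreyConst_mul_le_of_hasCompactSupport (hN : 1 ≤ N) (hs0 : 0 < s) (hs1 : s < 1)
    (hp : 1 ≤ p) (hα : 0 < alpha N s p) (hm : morreyConst N s p ≠ ∞) {φ : Rn N → ℝ}
    (hφ : Continuous φ) (hsupp : HasCompactSupport φ) {x y : Rn N} (hxy : x ≠ y) :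
    morreyConst N s p * ENNReal.ofReal (holderQuot s p φ x y) ^ p ≤ slobodeckijPow s p φ := by
  have hp0 : 0 < p := by linarith
  obtain ⟨ψ, h1, h2, h3, h4⟩ := exists_smooth_approx (s := s) hp hφ hsupp
  refine le_of_tendsto (tendsto_ofReal_holderQuot_rpow (h4 x) (h4 y) hm)
    (Eventually.of_forall fun n => ?_)
  refine le_trans ?_ ((morreyConst_mul_le_of_contDiff hN hs0 hs1 hp0 hα (h1 n) (h2 n)).trans (h3 n))
  gcongr
  exact ofReal_holderQuot_le hα _ hxy

theorem morreyConst_mul_le_of_bounded (hN : 1 ≤ N) (hs0 : 0 < s) (hs1 : s < 1)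
    (hp : 1 ≤ p) (hsp : (N : ℝ) < s * p) (hm : morreyConst N s p ≠ ∞) {φ : Rn N → ℝ}
    (hφ : Continuous φ) {b : ℝ} (hb : ∀ x, |φ x| ≤ b) {x y : Rn N} (hxy : x ≠ y) :
    morreyConst N s p * ENNReal.ofReal (holderQuot s p φ x y) ^ p ≤ slobodeckijPow s p φ := by
  have hp0 : 0 < p := by linarith
  have hα := alpha_pos hp0 hsp
  let η : ContDiffBump (0 : Rn N) := ⟨1, 2, one_pos, one_lt_two⟩
  have hηW := memW_of_contDiff hN hs0 hs1 hp0 hα η.contDiff η.hasCompactSupport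
  set ηn : ℕ → Rn N → ℝ := fun n x => η ((1 / ((n : ℝ) + 1)) • x) with hηn
  have hηc : ∀ n, Continuous (ηn n) := fun n => η.continuous.comp (continuous_const_smul _)
  have hlim : ∀ x, Tendsto (fun n => ηn n x * φ x) atTop (𝓝 (φ x)) := fun x => by
    have h1 : Tendsto (fun n : ℕ => (1 / ((n : ℝ) + 1)) • x) atTop (𝓝 ((0 : ℝ) • x)) :=
      tendsto_one_div_add_atTop_nhds_zero_nat.smul_const x
    have h2 := ((η.continuous.tendsto _).comp h1).mul_const (φ x)
    rwa [zero_smul, η.one_of_mem_closedBall (by simp [η.rIn_pos.le]), one_mul] at h2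
  have hslob : Tendsto (fun n => (slobNorm s p φ + ENNReal.ofReal b * slobNorm s p (ηn n)) ^ p) atTop
      (𝓝 (slobodeckijPow s p φ)) := by
    have h1 := tendsto_slobodeckijPow_comp_smul hsp hηW.1 hηW.3
    have h2 : Tendsto (fun n => slobNorm s p (ηn n)) atTop (𝓝 0) := by
      have := ((ENNReal.continuous_rpow_const (y := 1 / p)).tendsto _).comp h1
      rw [ENNReal.zero_rpow_of_pos (by positivity)] at this
      refine this.congr fun n => ?_
      rw [Function.comp_apply, slobodeckijPow_eq hp0, ← ENNReal.rpow_mul, mul_one_div_cancel hp0.ne',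
        ENNReal.rpow_one]
    have h3 := (ENNReal.Tendsto.const_mul h2 (Or.inr (ENNReal.ofReal_ne_top (r := b)))).const_add
      (slobNorm s p φ)
    rw [mul_zero, add_zero] at h3
    have := ((ENNReal.continuous_rpow_const (y := p)).tendsto _).comp h3
    rwa [← slobodeckijPow_eq hp0] at this
  refine le_of_tendsto_of_tendsto (tendsto_ofReal_holderQuot_rpow
    (ψ := fun n z => ηn n z * φ z) (hlim x) (hlim y) hm) hslob
    (Eventually.of_forall fun n => ?_)
  refine (morreyConst_mul_le_of_hasCompactSupport hN hs0 hs1 hp hα hm ((hηc n).mul hφ) ?_ hxy).trans ?_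
  · exact (η.hasCompactSupport.comp_homeomorph
      (Homeomorph.smulOfNeZero (1 / ((n : ℝ) + 1)) (by positivity))).mul_right
  · rw [slobodeckijPow_eq hp0]
    exact ENNReal.rpow_le_rpow (slobNorm_mul_le hp (hηc n) hφ (fun x => by
      rw [abs_of_nonneg η.nonneg]; exact η.le_one) hb) hp0.le

/-- Truncation between two levels. -/
def clamp (a b t : ℝ) : ℝ := max a (min b t)

theorem abs_clamp_sub_le (a b t r : ℝ) : |clamp a b t - clamp a b r| ≤ |t - r| :=
  (abs_max_sub_max_le_max _ _ _ _).trans (by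
    simpa using (abs_min_sub_min_le_max b t b r).trans (by simp))

theorem clamp_of_mem {a b t : ℝ} (h1 : a ≤ t) (h2 : t ≤ b) : clamp a b t = t := by
  rw [clamp, min_eq_right h2, max_eq_right h1]

theorem continuous_clamp (a b : ℝ) : Continuous (clamp a b) :=
  continuous_const.max (continuous_const.min continuous_id)

/-- The fractional Morrey inequality, with the sharp constant, for continuous functions. -/
theorem morreyConst_mul_le (hN : 1 ≤ N) (hs0 : 0 < s) (hs1 : s < 1)
    (hp : 1 ≤ p) (hsp : (N : ℝ) < s * p) (hm : morreyConst N s p ≠ ∞) {φ : Rn N → ℝ}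
    (hφ : Continuous φ) {x y : Rn N} (hxy : x ≠ y) :
    morreyConst N s p * ENNReal.ofReal (holderQuot s p φ x y) ^ p ≤ slobodeckijPow s p φ := by
  -- Truncation between the two values makes `φ` bounded, keeps the quotient at the pair and does
  -- not raise the energy.
  set a := min (φ x) (φ y) with ha
  set b := max (φ x) (φ y) with hb
  have hx : clamp a b (φ x) = φ x := clamp_of_mem (min_le_left _ _) (le_max_left _ _)
  have hy : clamp a b (φ y) = φ y := clamp_of_mem (min_le_right _ _) (le_max_right _ _)
  have hab : a ≤ b := min_le_max
  have h := morreyConst_mul_le_of_bounded hN hs0 hs1 hp hsp hm ((continuous_clamp a b).comp hφ)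
    (b := max |a| |b|) (fun z => abs_le_max_abs_abs (le_max_left _ _)
      (max_le hab (min_le_left _ _))) hxy
  have hq : holderQuot s p (clamp a b ∘ φ) x y = holderQuot s p φ x y := by
    simp [holderQuot, hx, hy]
  rw [hq] at h
  exact h.trans (slobodeckijPow_mono (by linarith) fun z w => abs_clamp_sub_le _ _ _ _)

/-! ### Attainment of the Hölder seminorm -/

/-- The measure on pairs of points with density the integrand of the Slobodeckij seminorm. -/
def slobMeasure (s p : ℝ) (u : Rn N → ℝ) : Measure (Rn N × Rn N) :=
  volume.withDensity fun z =>
    ENNReal.ofReal (|u z.1 - u z.2| ^ p / ‖z.1 - z.2‖ ^ (N + s * p))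

theorem slobMeasure_univ (u : Rn N → ℝ) : slobMeasure s p u univ = slobodeckijPow s p u := by
  rw [slobMeasure, withDensity_apply _ MeasurableSet.univ, Measure.restrict_univ, slobodeckijPow]

theorem measurableSet_diag : MeasurableSet {z : Rn N × Rn N | z.1 = z.2} :=
  (isClosed_eq continuous_fst continuous_snd).measurableSet

theorem slobMeasure_diag (hp : 0 < p) (u : Rn N → ℝ) :
    slobMeasure s p u {z | z.1 = z.2} = 0 := by
  rw [slobMeasure, withDensity_apply _ measurableSet_diag]
  refine setLIntegral_eq_zero measurableSet_diag fun z hz => ?_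
  have : z.1 = z.2 := hz
  simp [this, Real.zero_rpow hp.ne']

/-- Pairs of points that are close to each other, far from each other, or far from the origin. -/
def degeneratePairs (N n : ℕ) : Set (Rn N × Rn N) :=
  {z | ‖z.1 - z.2‖ ≤ 1 / ((n : ℝ) + 1) ∨ (n : ℝ) ≤ ‖z.1‖ ∨ (n : ℝ) ≤ ‖z.1 - z.2‖}

theorem isClosed_degeneratePairs (n : ℕ) : IsClosed (degeneratePairs N n) :=
  (isClosed_le (f := fun z : Rn N × Rn N => ‖z.1 - z.2‖) (by fun_prop) continuous_const).union
    ((isClosed_le (g := fun z : Rn N × Rn N => ‖z.1‖) continuous_const (by fun_prop)).union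
      (isClosed_le (g := fun z : Rn N × Rn N => ‖z.1 - z.2‖) continuous_const (by fun_prop)))

/-- The energy measure is finite, and the degenerate sets decrease to a subset of the diagonal,
which it does not charge. -/
theorem exists_slobMeasure_degeneratePairs_lt (hp : 0 < p) {u : Rn N → ℝ}
    (hfin : slobodeckijPow s p u < ∞) {κ : ℝ≥0∞} (hκ : 0 < κ) :
    ∃ n, slobMeasure s p u (degeneratePairs N n) < κ := by
  have hanti : Antitone (degeneratePairs N) := by
    intro m n hmn z hz
    have h : (m : ℝ) ≤ n := by exact_mod_cast hmn
    rcases hz with hz | hz | hz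
    · exact Or.inl (hz.trans (by gcongr))
    · exact Or.inr (Or.inl (h.trans hz))
    · exact Or.inr (Or.inr (h.trans hz))
  have hsub : ⋂ n, degeneratePairs N n ⊆ {z | z.1 = z.2} := by
    intro z hz
    by_contra hne
    have hd : 0 < ‖z.1 - z.2‖ := norm_pos_iff.2 (sub_ne_zero.2 hne)
    obtain ⟨n, h1, h2, h3⟩ := ((tendsto_one_div_add_atTop_nhds_zero_nat.eventually_lt_const hd).and
      ((tendsto_natCast_atTop_atTop.eventually_gt_atTop ‖z.1‖).and
        (tendsto_natCast_atTop_atTop.eventually_gt_atTop ‖z.1 - z.2‖))).exists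
    rcases mem_iInter.1 hz n with h | h | h <;> linarith
  have hlim := tendsto_measure_iInter_atTop (μ := slobMeasure s p u)
    (fun n => (isClosed_degeneratePairs (N := N) n).measurableSet.nullMeasurableSet) hanti
    ⟨0, ((measure_mono (subset_univ _)).trans_lt (by rwa [slobMeasure_univ])).ne⟩
  rw [measure_mono_null hsub (slobMeasure_diag hp u)] at hlim
  exact (hlim.eventually_lt_const hκ).exists

/-- A large difference quotient forces a definite amount of energy on balls around the points. -/
theorem exists_slobMeasure_ball_prod_ge (hα : 0 < alpha N s p) (hp : 0 < p) {u : Rn N → ℝ}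
    (hu : MemW s p u) {c : ℝ} (hc : 0 < c) :
    ∃ δ : ℝ, 0 < δ ∧ δ ≤ 1 / 4 ∧ ∃ κ : ℝ≥0∞, 0 < κ ∧ ∀ x y : Rn N, x ≠ y → c ≤ holderQuot s p u x y →
      κ ≤ slobMeasure s p u (Metric.ball x (δ * ‖x - y‖) ×ˢ Metric.ball y (δ * ‖x - y‖)) := by
  set H := (holderSeminorm s p u).toReal with hH
  have hH0 : 0 ≤ H := ENNReal.toReal_nonneg
  -- With this `δ`, `u` varies by at most `c/4 * R^α` on each ball, so increments between the balls
  -- stay above `c/2 * R^α`; `δ ≤ 1/4` keeps distances below `2 R`.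
  obtain ⟨δ, ⟨hδ1, hδ2⟩, hδ0⟩ : ∃ δ : ℝ, (H * δ ^ alpha N s p ≤ c / 4 ∧ δ ≤ 1 / 4) ∧ 0 < δ := by
    have h1 : Tendsto (fun δ : ℝ => H * δ ^ alpha N s p) (𝓝[>] 0) (𝓝 0) := by
      have : Tendsto (fun δ : ℝ => H * δ ^ alpha N s p) (𝓝 0) (𝓝 (H * 0 ^ alpha N s p)) :=
        (tendsto_id.rpow_const (Or.inr hα.le)).const_mul H
      rw [Real.zero_rpow hα.ne', mul_zero] at this
      exact this.mono_left nhdsWithin_le_nhds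
    have h2 : ∀ᶠ δ : ℝ in 𝓝[>] 0, δ ≤ 1 / 4 :=
      nhdsWithin_le_nhds (eventually_le_nhds (by norm_num))
    exact (((h1.eventually_le_const (by positivity : (0 : ℝ) < c / 4)).and h2).and
      self_mem_nhdsWithin).exists
  set ω := volume (Metric.ball (0 : Rn N) 1) with hω
  have hω0 : 0 < ω := Metric.measure_ball_pos _ _ one_pos
  set k : ℝ := (c / 2) ^ p / 2 ^ (N + s * p) * (δ ^ N * δ ^ N) with hk
  have hk0 : 0 < k := by positivity
  refine ⟨δ, hδ0, hδ2, ENNReal.ofReal k * (ω * ω), ENNReal.mul_pos (by simpa using hk0)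
    (mul_ne_zero hω0.ne' hω0.ne'), fun x y hxy hq => ?_⟩
  set R := ‖x - y‖ with hR
  have hR0 : 0 < R := norm_pos_iff.2 (sub_ne_zero.2 hxy)
  rw [holderQuot, le_div_iff₀ (by positivity)] at hq
  have hnear : ∀ a b : Rn N, a ∈ Metric.ball b (δ * R) → |u a - u b| ≤ c / 4 * R ^ alpha N s p := by
    intro a b hab
    rw [Metric.mem_ball, dist_eq_norm] at hab
    calc |u a - u b| ≤ H * ‖a - b‖ ^ alpha N s p := hu.exists_holder hα a b
      _ ≤ H * (δ * R) ^ alpha N s p := by gcongr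
      _ = H * δ ^ alpha N s p * R ^ alpha N s p := by
          rw [Real.mul_rpow hδ0.le hR0.le, mul_assoc]
      _ ≤ _ := by gcongr
  have hlow : ∀ z ∈ Metric.ball x (δ * R) ×ˢ Metric.ball y (δ * R),
      ENNReal.ofReal ((c / 2 * R ^ alpha N s p) ^ p / (2 * R) ^ (N + s * p)) ≤
        ENNReal.ofReal (|u z.1 - u z.2| ^ p / ‖z.1 - z.2‖ ^ (N + s * p)) := by
    rintro ⟨a, b⟩ ⟨ha, hb⟩
    have h1 := hnear a x ha
    have h2 := hnear b y hb
    simp only [Metric.mem_ball, dist_eq_norm] at ha hb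
    have hab1 : c / 2 * R ^ alpha N s p ≤ |u a - u b| := by
      have e : u x - u y = -(u a - u x) + (u a - u b) + (u b - u y) := by ring
      have := abs_add_three (-(u a - u x)) (u a - u b) (u b - u y)
      rw [← e, abs_neg] at this
      linarith
    have hab3 : ‖a - b‖ ≤ 2 * R := by
      have e : a - b = (a - x) + (x - y) + -(b - y) := by abel
      have := norm_add₃_le (a := a - x) (b := x - y) (c := -(b - y))
      rw [← e, norm_neg] at this
      nlinarith
    have hab0 : 0 < ‖a - b‖ := norm_pos_iff.2 (sub_ne_zero.2 (by
      rintro rfl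
      simp only [sub_self, abs_zero] at hab1
      have : 0 < c / 2 * R ^ alpha N s p := by positivity
      linarith))
    refine ENNReal.ofReal_le_ofReal ?_
    have hexp : 0 < N + s * p := by
      have : 0 < alpha N s p * p := by positivity
      rw [alpha, sub_mul, div_mul_cancel₀ _ hp.ne'] at this
      have : (0 : ℝ) ≤ N := by positivity
      linarith
    simp only
    gcongr
  have hball : ∀ x : Rn N, volume (Metric.ball x (δ * R)) = ENNReal.ofReal ((δ * R) ^ N) * ω :=
    fun x => by
      rw [Measure.addHaar_ball_of_pos _ _ (by positivity)]
      simp [hω]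
  have hms : MeasurableSet (Metric.ball x (δ * R) ×ˢ Metric.ball y (δ * R)) :=
    measurableSet_ball.prod measurableSet_ball
  rw [slobMeasure, withDensity_apply _ hms]
  refine le_trans ?_ (setLIntegral_mono' hms hlow)
  rw [setLIntegral_const, Measure.volume_eq_prod, Measure.prod_prod, hball, hball,
    mul_mul_mul_comm (ENNReal.ofReal _) ω,
    ← ENNReal.ofReal_mul (by positivity : 0 ≤ (δ * R) ^ N), ← mul_assoc _ _ (ω * ω),
    ← ENNReal.ofReal_mul (by positivity)]
  gcongr
  rw [hk]
  apply le_of_eq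
  -- Scale invariance, `α p + 2 N = N + s p`: the powers of `R` cancel, so the bound is uniform over
  -- pairs.
  have e1 : (R ^ alpha N s p) ^ p * (R ^ N * R ^ N) = R ^ (N + s * p) := by
    rw [← Real.rpow_mul hR0.le, ← Real.rpow_natCast, ← Real.rpow_add hR0, ← Real.rpow_add hR0]
    congr 1
    rw [alpha, sub_mul, div_mul_cancel₀ _ hp.ne']
    ring
  rw [Real.mul_rpow (by positivity) (by positivity), Real.mul_rpow (by positivity) hR0.le, ← e1,
    mul_pow]
  field_simp

/-- The Hölder seminorm of a non-constant function in `𝒲^{s,p}` is attained. -/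
theorem MemW.exists_attainsHolder (hα : 0 < alpha N s p) (hp : 0 < p) {u : Rn N → ℝ}
    (hu : MemW s p u) (hne : holderSeminorm s p u ≠ 0) :
    ∃ x y : Rn N, AttainsHolder s p u x y := by
  set H := (holderSeminorm s p u).toReal with hH
  have hH0 : 0 < H := ENNReal.toReal_pos hne hu.2.ne
  have hHe : holderSeminorm s p u = ENNReal.ofReal H := (ENNReal.ofReal_toReal hu.2.ne).symm
  obtain ⟨δ, hδ0, hδ, κ, hκ, hge⟩ := exists_slobMeasure_ball_prod_ge hα hp hu (half_pos hH0)
  obtain ⟨n, hn⟩ := exists_slobMeasure_degeneratePairs_lt hp hu.3 hκ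
  -- A pair with quotient at least `H / 2` has a non-degenerate pair `(a, b)` in its balls, with `|x
  -- - y| / 2 ≤ |a - b| ≤ 2 |x - y|`; these constants follow by the triangle inequality.
  set K : Set (Rn N × Rn N) :=
    {z | ‖z.1‖ ≤ 2 * n ∧ ‖z.2‖ ≤ 4 * n ∧ 1 / (2 * ((n : ℝ) + 1)) ≤ ‖z.1 - z.2‖} with hK
  have hKc : IsCompact K := by
    refine ((isCompact_closedBall (0 : Rn N) (2 * n)).prod
      (isCompact_closedBall (0 : Rn N) (4 * n))).of_isClosed_subset ?_ ?_
    · exact (isClosed_le (f := fun z : Rn N × Rn N => ‖z.1‖) (by fun_prop) continuous_const).inter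
        ((isClosed_le (f := fun z : Rn N × Rn N => ‖z.2‖) (by fun_prop) continuous_const).inter
          (isClosed_le (g := fun z : Rn N × Rn N => ‖z.1 - z.2‖) continuous_const (by fun_prop)))
    · rintro z ⟨h1, h2, -⟩
      simp [h1, h2]
  have hmem : ∀ x y : Rn N, x ≠ y → H / 2 ≤ holderQuot s p u x y → (x, y) ∈ K := by
    intro x y hxy hq
    have hnot : ¬ Metric.ball x (δ * ‖x - y‖) ×ˢ Metric.ball y (δ * ‖x - y‖) ⊆
        degeneratePairs N n := fun hsub =>
      absurd ((hge x y hxy hq).trans (measure_mono hsub)) (not_le.2 hn)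
    obtain ⟨⟨a, b⟩, ⟨ha, hb⟩, hab⟩ := not_subset.1 hnot
    simp only [Metric.mem_ball, dist_eq_norm] at ha hb
    simp only [degeneratePairs, mem_ofPred_eq, not_or, not_le] at hab
    obtain ⟨h1, h2, h3⟩ := hab
    have hR0 : 0 < ‖x - y‖ := norm_pos_iff.2 (sub_ne_zero.2 hxy)
    have ha' : ‖a - x‖ ≤ ‖x - y‖ / 4 := by nlinarith
    have hb' : ‖b - y‖ ≤ ‖x - y‖ / 4 := by nlinarith
    have h4 : ‖a - b‖ ≤ ‖x - y‖ * 2 := by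
      have e : a - b = (a - x) + (x - y) + -(b - y) := by abel
      have := norm_add₃_le (a := a - x) (b := x - y) (c := -(b - y))
      rw [← e, norm_neg] at this
      linarith
    have h5 : ‖x - y‖ / 2 ≤ ‖a - b‖ := by
      have e : x - y = -(a - x) + (a - b) + (b - y) := by abel
      have := norm_add₃_le (a := -(a - x)) (b := a - b) (c := b - y)
      rw [← e, norm_neg] at this
      linarith
    have h6 : ‖x‖ ≤ ‖a‖ + ‖a - x‖ := by
      have := norm_sub_le a (a - x)
      rwa [sub_sub_cancel] at this
    have h7 : ‖y‖ ≤ ‖x‖ + ‖x - y‖ := by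
      have := norm_sub_le x (x - y)
      rwa [sub_sub_cancel] at this
    refine ⟨by simp only; linarith, by simp only; linarith, ?_⟩
    simp only
    rw [one_div, mul_inv, ← one_div ((n : ℝ) + 1)]
    linarith
  have hcont : ContinuousOn (fun z : Rn N × Rn N => holderQuot s p u z.1 z.2) K := by
    have h1 : Continuous fun z : Rn N × Rn N => |u z.1 - u z.2| :=
      ((hu.1.comp continuous_fst).sub (hu.1.comp continuous_snd)).abs
    have h2 : Continuous fun z : Rn N × Rn N => ‖z.1 - z.2‖ ^ alpha N s p :=
      (by fun_prop : Continuous fun z : Rn N × Rn N => ‖z.1 - z.2‖).rpow_const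
        fun _ => Or.inr hα.le
    refine h1.continuousOn.div h2.continuousOn fun z hz => ?_
    have : 0 < ‖z.1 - z.2‖ := lt_of_lt_of_le (by positivity) hz.2.2
    positivity
  obtain ⟨x₁, y₁, hxy₁, hq₁⟩ : ∃ x y : Rn N, x ≠ y ∧ H / 2 < holderQuot s p u x y := by
    by_contra! hcon
    have : holderSeminorm s p u ≤ ENNReal.ofReal (H / 2) := by
      rw [holderSeminorm_eq_iSup hα]
      exact iSup_le fun x => iSup_le fun y => iSup_le fun hxy =>
        ENNReal.ofReal_le_ofReal (hcon x y hxy)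
    rw [hHe, ENNReal.ofReal_le_ofReal_iff (by positivity)] at this
    linarith
  obtain ⟨⟨x₀, y₀⟩, hmem₀, hmax⟩ := hKc.exists_isMaxOn ⟨_, hmem x₁ y₁ hxy₁ hq₁.le⟩ hcont
  have hq₀ : H / 2 < holderQuot s p u x₀ y₀ := hq₁.trans_le (hmax (hmem x₁ y₁ hxy₁ hq₁.le))
  have hxy₀ : x₀ ≠ y₀ := by
    rintro rfl
    have h : 1 / (2 * ((n : ℝ) + 1)) ≤ ‖x₀ - x₀‖ := hmem₀.2.2
    rw [sub_self, norm_zero] at h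
    have : 0 < 1 / (2 * ((n : ℝ) + 1)) := by positivity
    linarith
  refine ⟨x₀, y₀, hxy₀, le_antisymm ?_ (ofReal_holderQuot_le hα u hxy₀)⟩
  rw [holderSeminorm_eq_iSup hα]
  refine iSup_le fun x => iSup_le fun y => iSup_le fun hxy => ENNReal.ofReal_le_ofReal ?_
  rcases le_total (H / 2) (holderQuot s p u x y) with h | h
  · exact hmax (hmem x y hxy h)
  · exact h.trans hq₀.le

/-! ### Bounds for extremals -/

theorem IsExtremal.holderSeminorm_ne_zero (hα : 0 < alpha N s p) {u : Rn N → ℝ}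
    (hu : IsExtremal s p u) : holderSeminorm s p u ≠ 0 := fun h0 => by
  refine hu.nonconstant ⟨u 0, fun x => ?_⟩
  have := hu.memW.exists_holder hα x 0
  rw [h0, ENNReal.toReal_zero, zero_mul] at this
  exact sub_eq_zero.1 (abs_nonpos_iff.1 this)

theorem IsExtremal.morreyConst_ne_top (hα : 0 < alpha N s p) {u : Rn N → ℝ}
    (hu : IsExtremal s p u) : morreyConst N s p ≠ ∞ := fun h => by
  have h1 := hu.memW.slobodeckij_lt_top
  rw [hu.eq, h, ENNReal.top_mul] at h1
  · exact lt_irrefl _ h1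
  · simp [hu.holderSeminorm_ne_zero hα, hu.memW.2.ne]

theorem IsExtremal.morreyConst_ne_zero (hp : 0 < p) {u : Rn N → ℝ}
    (hu : IsExtremal s p u) : morreyConst N s p ≠ 0 := fun h => by
  have h1 := hu.eq
  rw [h, zero_mul] at h1
  exact hu.nonconstant ⟨u 0, fun x => eq_of_slobodeckijPow_eq_zero hp hu.memW.1 h1 x 0⟩

theorem AttainsHolder.apply_ne {u : Rn N → ℝ} {x y : Rn N} (h : AttainsHolder s p u x y)
    (hne : holderSeminorm s p u ≠ 0) : u x ≠ u y := fun e => hne (by rw [h.2, e]; simp)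

/-- The truncated function still has the full quotient at `(x₀, y₀)`, so Morrey's inequality gives
it at least the energy of `u`. By rigidity truncation preserves every increment. -/
theorem IsExtremal.mem_Icc (hN : 1 ≤ N) (hs0 : 0 < s) (hs1 : s < 1) (hp : 1 < p)
    (hsp : (N : ℝ) < s * p) {u : Rn N → ℝ} (hu : IsExtremal s p u) {x₀ y₀ : Rn N}
    (h₀ : AttainsHolder s p u x₀ y₀) (x : Rn N) :
    min (u x₀) (u y₀) ≤ u x ∧ u x ≤ max (u x₀) (u y₀) := by
  have hp0 : 0 < p := by linarith
  have hα := alpha_pos hp0 hsp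
  set a := min (u x₀) (u y₀) with ha
  set b := max (u x₀) (u y₀) with hb
  have hab : a ≤ b := min_le_max
  have hx : clamp a b (u x₀) = u x₀ := clamp_of_mem (min_le_left _ _) (le_max_left _ _)
  have hy : clamp a b (u y₀) = u y₀ := clamp_of_mem (min_le_right _ _) (le_max_right _ _)
  have hTc : Continuous fun z => clamp a b (u z) := (continuous_clamp a b).comp hu.memW.1
  have hT := hu.memW.of_abs_le hα hp0.le hTc fun z w => abs_clamp_sub_le a b (u z) (u w)
  have hle : slobodeckijPow s p u ≤ slobodeckijPow s p fun z => clamp a b (u z) := by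
    have := morreyConst_mul_le hN hs0 hs1 hp.le hsp (hu.morreyConst_ne_top hα) hTc h₀.1
    rw [hu.eq, h₀.2]
    simpa only [holderQuot, hx, hy] using this
  have key := abs_sub_eq_of_slobodeckijPow_le hp0 hTc hu.memW.1
    (fun z w => abs_clamp_sub_le a b (u z) (u w)) hT.3 hle
  -- If truncation sends `u x` to a value `t` that `u` takes at `w` and that truncation fixes, the
  -- increment between `x` and `w` becomes `0`, so it already was `0`.
  have key' : ∀ t w, u w = t → clamp a b t = t → clamp a b (u x) = t → u x = t := by
    intro t w hw ht hxt
    have := key x w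
    rw [hw, ht, hxt, sub_self, abs_zero, eq_comm, abs_eq_zero, sub_eq_zero] at this
    exact this
  have key₀ : ∀ t, t = u x₀ ∨ t = u y₀ → clamp a b (u x) = t → u x = t := by
    rintro t (rfl | rfl) h
    · exact key' _ x₀ rfl hx h
    · exact key' _ y₀ rfl hy h
  constructor
  · by_contra! hlt
    have := key₀ a (min_choice _ _) (by
      rw [clamp, min_eq_right (hlt.le.trans hab), max_eq_left hlt.le])
    exact hlt.ne this
  · by_contra! hlt
    have := key₀ b (max_choice _ _) (by rw [clamp, min_eq_left hlt.le, max_eq_right hab])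
    exact hlt.ne' this

/-! ### Euler-Lagrange equation and uniqueness of the pair -/

theorem abs_add_rpow_deriv_le (hp : 1 < p) {t : ℝ} (ht : |t| ≤ 1) (a b : ℝ) :
    |p * J p (a + t * b) * b| ≤ p * (|a| + |b|) ^ p := by
  have h : |a + t * b| ≤ |a| + |b| := by
    refine (abs_add_le _ _).trans ?_
    rw [abs_mul]
    nlinarith [abs_nonneg b]
  rw [abs_mul, abs_mul, abs_J hp, abs_of_pos (by linarith : 0 < p), mul_assoc,
    ← rpow_sub_one_mul_self hp (by positivity : 0 ≤ |a| + |b|)]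
  gcongr
  linarith [abs_nonneg a]

theorem hasDerivAt_abs_add_mul_rpow (hp : 1 < p) (a b t : ℝ) :
    HasDerivAt (fun t : ℝ => |a + t * b| ^ p) (p * J p (a + t * b) * b) t := by
  have h1 : HasDerivAt (fun t : ℝ => a + t * b) b t := by
    simpa using ((hasDerivAt_id t).mul_const b).const_add a
  have := (hasDerivAt_abs_rpow (a + t * b) hp).comp t h1
  refine (this.congr_deriv ?_).congr_of_eventuallyEq (Eventually.of_forall fun _ => rfl)
  rw [J]; ring

/-- The derivative of `t ↦ [u + t φ]^p` at `t = 0`. -/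
theorem hasDerivAt_slobodeckij (hp : 1 < p) {u φ : Rn N → ℝ} (hu : MemW s p u) (hφ : MemW s p φ) :
    HasDerivAt (fun t : ℝ => (slobodeckijPow s p fun x => u x + t * φ x).toReal)
      (∫ z, p * J p (kerDiff s p u z) * kerDiff s p φ z) 0 := by
  have hp0 : 0 < p := by linarith
  set A := kerDiff s p u with hA
  set B := kerDiff s p φ with hB
  have hAm : Measurable A := measurable_kerDiff hu.1
  have hBm : Measurable B := measurable_kerDiff hφ.1
  have e : (fun t : ℝ => (slobodeckijPow s p fun x => u x + t * φ x).toReal) =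
      fun t => ∫ z, |A z + t * B z| ^ p := by
    ext t
    rw [(hu.add hp.le (hφ.const_mul hp.le t)).slobodeckijPow_eq_integral hp0,
      ENNReal.toReal_ofReal (integral_nonneg fun z => by positivity)]
    refine integral_congr_ae (ae_of_all _ fun z => ?_)
    simp only
    rw [← abs_kerDiff_rpow hp0.ne' (fun x => u x + t * φ x) z, kerDiff_add, kerDiff_smul]
    rfl
  have hbound : Integrable fun z => p * (|A z| + |B z|) ^ p := by
    have := (((hu.memLp hp0).abs.add (hφ.memLp hp0).abs).integrable_norm_rpow
      (by simpa using hp0) (by simp)).const_mul p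
    rw [ENNReal.toReal_ofReal hp0.le] at this
    refine this.congr (ae_of_all _ fun z => ?_)
    simp only [Pi.add_apply, Pi.abs_apply, Real.norm_eq_abs]
    rw [abs_of_nonneg (by positivity)]
  have hint0 : Integrable fun z => |A z + 0 * B z| ^ p := by
    have := (hu.memLp hp0).integrable_norm_rpow (by simpa using hp0) (by simp)
    rw [ENNReal.toReal_ofReal hp0.le] at this
    simpa using this
  have hJ : Measurable fun z => p * J p (A z + 0 * B z) * B z :=
    (((continuous_J hp).measurable.comp (hAm.add (hBm.const_mul 0))).const_mul p).mul hBm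
  have := (hasDerivAt_integral_of_dominated_loc_of_deriv_le (μ := volume)
    (F := fun t z => |A z + t * B z| ^ p) (F' := fun t z => p * J p (A z + t * B z) * B z)
    (x₀ := (0 : ℝ)) (bound := fun z => p * (|A z| + |B z|) ^ p)
    (Metric.ball_mem_nhds 0 one_pos)
    (Eventually.of_forall fun t =>
      ((hAm.add (hBm.const_mul t)).abs.pow_const p).aestronglyMeasurable)
    hint0 hJ.aestronglyMeasurable
    (ae_of_all _ fun z t ht => abs_add_rpow_deriv_le hp (by
      rw [Metric.mem_ball, dist_zero_right] at ht; exact ht.le) _ _)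
    hbound (ae_of_all _ fun z t _ => hasDerivAt_abs_add_mul_rpow hp _ _ _)).2
  rw [e]
  simpa only [zero_mul, add_zero] using this

/-- The Euler-Lagrange equation of an extremal. -/
theorem IsExtremal.euler_lagrange (hN : 1 ≤ N) (hs0 : 0 < s) (hs1 : s < 1) (hp : 1 < p)
    (hsp : (N : ℝ) < s * p) {u : Rn N → ℝ} (hu : IsExtremal s p u) {x y : Rn N}
    (h : AttainsHolder s p u x y) {φ : Rn N → ℝ} (hφ : MemW s p φ) :
    ∫ z, p * J p (kerDiff s p u z) * kerDiff s p φ z =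
      (morreyConst N s p).toReal / (‖x - y‖ ^ alpha N s p) ^ p *
        (p * J p (u x - u y) * (φ x - φ y)) := by
  have hp0 : 0 < p := by linarith
  have hα := alpha_pos hp0 hsp
  have hm := hu.morreyConst_ne_top hα
  set c := (morreyConst N s p).toReal / (‖x - y‖ ^ alpha N s p) ^ p with hc
  have hR : 0 ≤ ‖x - y‖ ^ alpha N s p := by positivity
  have hq : ∀ t : ℝ, (morreyConst N s p *
      ENNReal.ofReal (holderQuot s p (fun z => u z + t * φ z) x y) ^ p).toReal =
      c * |(u x - u y) + t * (φ x - φ y)| ^ p := fun t => by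
    rw [ENNReal.toReal_mul, ← ENNReal.toReal_rpow, ENNReal.toReal_ofReal (holderQuot_nonneg _ _ _),
      holderQuot, Real.div_rpow (abs_nonneg _) hR, hc,
      show u x + t * φ x - (u y + t * φ y) = (u x - u y) + t * (φ x - φ y) by ring]
    ring
  have h1 := hasDerivAt_slobodeckij hp hu.memW hφ
  have h2 := (hasDerivAt_abs_add_mul_rpow hp (u x - u y) (φ x - φ y) 0).const_mul c
  -- Morrey's inequality at the fixed pair makes this difference nonnegative, and extremality makes
  -- it `0` at `t = 0`; thus no supremum has to be differentiated.
  have hmin : IsLocalMin (fun t : ℝ => (slobodeckijPow s p fun z => u z + t * φ z).toReal -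
      c * |(u x - u y) + t * (φ x - φ y)| ^ p) 0 := by
    refine Eventually.of_forall fun t => ?_
    have hW := hu.memW.add hp.le (hφ.const_mul hp.le t)
    have ht := ENNReal.toReal_mono hW.3.ne
      (morreyConst_mul_le hN hs0 hs1 hp.le hsp hm hW.1 h.1)
    rw [hq] at ht
    have h0 := hq 0
    simp only [zero_mul, add_zero] at h0 ⊢
    have h3 : ENNReal.ofReal (holderQuot s p (fun z => u z) x y) = holderSeminorm s p u := h.2.symm
    rw [← h0, h3, ← hu.eq]
    linarith
  have := hmin.hasDerivAt_eq_zero (h1.sub h2)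
  simp only [zero_mul, add_zero] at this
  linarith

theorem exists_memW_separating (hN : 1 ≤ N) (hs0 : 0 < s) (hs1 : s < 1) (hp : 0 < p)
    (hα : 0 < alpha N s p) {F : Set (Rn N)} (hF : F.Finite) {x : Rn N} (hx : x ∉ F) :
    ∃ φ : Rn N → ℝ, MemW s p φ ∧ φ x = 1 ∧ ∀ y ∈ F, φ y = 0 := by
  obtain ⟨f, h1, h2, h3, -, h5⟩ := exists_contDiff_tsupport_subset (n := (⊤ : ℕ∞))
    (hF.isClosed.isOpen_compl.mem_nhds hx)
  exact ⟨f, memW_of_contDiff hN hs0 hs1 hp hα h3 h2, h5, fun y hy =>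
    image_eq_zero_of_notMem_tsupport fun hy' => h1 hy' hy⟩

/-- Otherwise some `φ` equals `1` at `x₁` and `0` at `x₀`, `y₀`, `y₁`. Equating the two
Euler-Lagrange right-hand sides then gives `0` for the first pair and a nonzero multiple of `J p (u
x₁ - u y₁)` for the second. -/
theorem IsExtremal.mem_pair_of_attainsHolder (hN : 1 ≤ N) (hs0 : 0 < s) (hs1 : s < 1) (hp : 1 < p)
    (hsp : (N : ℝ) < s * p) {u : Rn N → ℝ} (hu : IsExtremal s p u) {x₀ y₀ x₁ y₁ : Rn N}
    (h₀ : AttainsHolder s p u x₀ y₀) (h₁ : AttainsHolder s p u x₁ y₁) : x₁ = x₀ ∨ x₁ = y₀ := by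
  have hp0 : 0 < p := by linarith
  have hα := alpha_pos hp0 hsp
  by_contra! hne
  obtain ⟨φ, hφ, hφ1, hφ0⟩ := exists_memW_separating hN hs0 hs1 hp0 hα
    (F := {x₀, y₀, y₁}) (by simp) (x := x₁) (by simp [hne, h₁.1])
  have e := (hu.euler_lagrange hN hs0 hs1 hp hsp h₀ hφ).symm.trans
    (hu.euler_lagrange hN hs0 hs1 hp hsp h₁ hφ)
  rw [hφ1, hφ0 x₀ (by simp), hφ0 y₀ (by simp), hφ0 y₁ (by simp), sub_self, mul_zero, mul_zero,
    sub_zero, mul_one] at e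
  have hd : 0 < ‖x₁ - y₁‖ := norm_pos_iff.2 (sub_ne_zero.2 h₁.1)
  have hm : 0 < (morreyConst N s p).toReal :=
    ENNReal.toReal_pos (hu.morreyConst_ne_zero hp0) (hu.morreyConst_ne_top hα)
  have hJ : J p (u x₁ - u y₁) ≠ 0 := by
    have : 0 < |u x₁ - u y₁| :=
      abs_pos.2 (sub_ne_zero.2 (h₁.apply_ne (hu.holderSeminorm_ne_zero hα)))
    rw [← abs_pos, abs_J hp]
    positivity
  have : (morreyConst N s p).toReal / (‖x₁ - y₁‖ ^ alpha N s p) ^ p * (p * J p (u x₁ - u y₁)) ≠ 0 :=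
    mul_ne_zero (by positivity) (mul_ne_zero hp0.ne' hJ)
  exact this e.symm

theorem AttainsHolder.symm {u : Rn N → ℝ} {x y : Rn N} (h : AttainsHolder s p u x y) :
    AttainsHolder s p u y x :=
  ⟨h.1.symm, by rw [h.2, abs_sub_comm, norm_sub_rev]⟩

end FracMorrey

end

theorem theorem7p6 (N : ℕ) (hN : 1 ≤ N) (s p : ℝ) (hs0 : 0 < s) (hs1 : s < 1) (hp : 1 < p)
    (hsp : (N : ℝ) < s * p) :
    (∀ (μ : SignedMeasure (FracMorrey.Rn N)) (U : FracMorrey.Rn N → ℝ),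
      IsCompact (FracMorrey.signedSupport μ) →
      FracMorrey.IsWeakSolution s p U μ →
        MemLp U ∞ volume ∧
        (μ ≠ 0 → ∀ z : FracMorrey.Rn N, ∃ x₀ ∈ FracMorrey.signedSupport μ,
          IsMaxOn (fun x => |U x - U z|) univ x₀ ∧
          eLpNorm (fun x => U x - U z) ∞ volume = ENNReal.ofReal |U x₀ - U z|) ∧
        (μ = 0 → ∀ x y : FracMorrey.Rn N, U x = U y)) ∧
    (∀ u : FracMorrey.Rn N → ℝ, FracMorrey.IsExtremal s p u →
      MemLp u ∞ volume ∧
      ∃ x₀ y₀ : FracMorrey.Rn N, FracMorrey.AttainsHolder s p u x₀ y₀ ∧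
        (∀ x₁ y₁ : FracMorrey.Rn N, FracMorrey.AttainsHolder s p u x₁ y₁ →
          (x₁ = x₀ ∧ y₁ = y₀) ∨ (x₁ = y₀ ∧ y₁ = x₀)) ∧
        ∀ x : FracMorrey.Rn N, min (u x₀) (u y₀) ≤ u x ∧ u x ≤ max (u x₀) (u y₀)) := by
  have hp0 : 0 < p := by linarith
  have hα := FracMorrey.alpha_pos hp0 hsp
  refine ⟨fun μ U hK hU => hU.maximum_principle hα hp hK, fun u hu => ?_⟩
  obtain ⟨x₀, y₀, h₀⟩ := hu.memW.exists_attainsHolder hα hp0 (hu.holderSeminorm_ne_zero hα)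
  have hbd := hu.mem_Icc hN hs0 hs1 hp hsp h₀
  refine ⟨FracMorrey.memLp_top_of_bounded hu.memW.1 hbd, x₀, y₀, h₀, fun x₁ y₁ h₁ => ?_, hbd⟩
  have hx := hu.mem_pair_of_attainsHolder hN hs0 hs1 hp hsp h₀ h₁
  -- The swapped pair also attains, which locates `y₁`; `x₁ ≠ y₁` then leaves only the two
  -- orderings.
  have hy := hu.mem_pair_of_attainsHolder hN hs0 hs1 hp hsp h₀ h₁.symm
  have hne := h₁.1
  rcases hx with rfl | rfl <;> rcases hy with rfl | rfl <;> simp_all
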